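/- **Setting.** Let $\beta>0$ and $q=\lfloor 2/\beta\rfloor$. For every sample size $n$ let $\Sigma_n\in\mathbb R^{d_n\times d_n}$ be positive semi-definite with $\|\Sigma_n\|_{op}=1$ and effective dimension $d_{\mathrm{eff}}=\mathrm{tr}(\Sigma_n)/\|\Sigma_n\|_{op}$, and assume $d_{\mathrm{eff}}/n^{\beta}\to c_0$ for some $c_0>0$. Let $W$ be a random vector with i.i.d. entries that are either standard normal, or of mean zero, unit variance and bounded by $R$, where $R$ does not depend on $n$. The input law $P_X$ (depending on $n$) is, for all $n$, the law of $\Sigma_n^{1/2}W$ (*covariance model*), or, for all $n$, the law of $\sqrt{d_{\mathrm{eff}}}\,Z/\|Z\|$ with $Z=\Sigma_n^{1/2}W$ (*spherical model*). Let $(x,y)$ have a joint law with input marginal $P_X$ and $\mathbb E|y|<\infty$; the ground truth $f^\star(x)=\mathbb E[y\mid X=x]$ (which may depend on $n$) is bounded, uniformly in $n$. For each $n$ the inputs $\mathbf X=(x_1,\dots,x_n)$ are i.i.d. with law $P_X$, all on one probability space, with arbitrary dependence between different $n$. Let $g$ be a function of three real variables that does not depend on $n$, and let $k_\tau(x,x')=g\big(\tfrac{\|x\|^2}{\tau},\tfrac{\|x'\|^2}{\tau},\tfrac{x^\top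 x'}{\tau}\big)$ with $\tau=d_{\mathrm{eff}}$ be a continuous positive semi-definite kernel on a set $\mathcal X\subset\mathbb R^{d_n}$ that carries $P_X$, with reproducing kernel Hilbert space $\mathcal H$. For $\lambda>0$ let $\hat f_\lambda\in\mathcal H$ minimise $\sum_i (y_i-f(x_i))^2+\lambda\|f\|_{\mathcal H}^2$, and let $\hat f_0\in\mathcal H$ be the interpolant of the data $(x_i,y_i)$ of minimal norm. Let $\mathbb E_Y\hat f_\lambda$ be the average of $\hat f_\lambda$ over independent $y_i\sim P(Y\mid X=x_i)$, and $\mathbf B(\hat f_\lambda)=\|\mathbb E_Y\hat f_\lambda-f^\star\|^2_{L_2(P_X)}$ the (squared) bias. Here $\lambda=\lambda_n\ge 0$ may depend on $n$. **Assumptions.** (i) In the covariance model there are $\delta,\delta'>0$ with $$g(s,t,u)=\sum_{j=0}^{q} g_j(s,t)\,u^j+u^{q+1}\,r(s,t,u)\qquad\text{for } s,t\in[1-\delta,1+\delta],\ u\in[-\delta',\delta'],$$ where $g_j$ is $(q+1-j)$-times continuously differentiable in a neighbourhood of $(1,1)$ and $r$ is continuous in a neighbourhood of $(1,1,0)$.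 In the spherical model only the restriction of the kernel to the unit sphere needs such an expansion: $g(1,1,u)=\sum_{j=0}^{q}a_ju^j+u^{q+1}r(u)$ for $|u|\le\delta'$, with numbers $a_j$ and with $r$ continuous in a neighbourhood of $0$. (ii) With $K=(k_\tau(x_i,x_j))_{i,j\le n}$ there is a constant $c>0$ such that, almost surely, all eigenvalues of $K+\lambda I_n$ are at least $c$ for all sufficiently large $n$. **Theorem.** Let $m=2\lfloor 2/\beta\rfloor$ in the covariance model and $m=\lfloor 2/\beta\rfloor$ in the spherical model, and let $\mathcal P_{\le m}$ be the space of polynomials on $\mathbb R^{d_n}$ of degree at most $m$. 1. For every $\varepsilon>0$, almost surely, for all sufficiently large $n$, $$\mathbf B(\hat f_\lambda)\ \ge\ \inf_{p\in\mathcal P_{\le m}}\|f^\star-p\|^2_{L_2(P_X)}-\varepsilon .$$ 2. There are polynomials $p=p_{n,\mathbf X}\in\mathcal P_{\le m}$, depending on $n$ and on the data inputs, such that: - for all $\varepsilon,\varepsilon'>0$ there is $C>0$ such that almost surely, for all sufficiently large $n$, with probability at least $1-n^2\exp(-C(\log n)^{1+\varepsilon'})$ over an independent draw $X\sim P_X$,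 $$|\mathbb E_Y\hat f_\lambda(X)-p(X)|\le\varepsilon;$$ - if the kernels $k_\tau$ are bounded on the support of $P_X$ (uniformly in $n$), then almost surely $\|\mathbb E_Y\hat f_\lambda-p\|_{L_2(P_X)}\to 0$ as $n\to\infty$. -/

import Mathlib

open MeasureTheory ProbabilityTheory Filter Topology Matrix
open scoped ENNReal MatrixOrder Matrix.Norms.L2Operator

noncomputable section

namespace PolyBarrier

/-- `d`-dimensional Euclidean space. -/
abbrev E (d : ℕ) : Type := EuclideanSpace ℝ (Fin d)

/-! ### Input distributions -/

/-- The two input models: covariance model, and its projection onto a sphere. -/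
inductive InputModel where
  | cov
  | sphere

/-- Admissible laws of one coordinate of the latent vector `W`: standard normal, or mean zero,
unit variance and supported in `[-R, R]`. -/
def IsEntryLaw (R : ℝ) (ν : Measure ℝ) : Prop :=
  ν = gaussianReal 0 1 ∨
    (IsProbabilityMeasure ν ∧ (∀ᵐ w ∂ν, |w| ≤ R) ∧ ∫ w, w ∂ν = 0 ∧ ∫ w, w ^ 2 ∂ν = 1)

/-- The effective dimension `tr Σ / ‖Σ‖_op`. -/
def effDim {d : ℕ} (S : Matrix (Fin d) (Fin d) ℝ) : ℝ := S.trace / ‖S‖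

/-- The law of `Σ^{1/2} W`, where `W` has i.i.d. entries with law `ν`. -/
def covLaw {d : ℕ} (S : Matrix (Fin d) (Fin d) ℝ) (ν : Measure ℝ) : Measure (E d) :=
  (Measure.pi fun _ : Fin d => ν).map fun w => WithLp.toLp 2 (CFC.sqrt S *ᵥ w)

/-- The law of `√d_eff Z / ‖Z‖` with `Z = Σ^{1/2} W` (and `0` if `Z = 0`). -/
def sphereLaw {d : ℕ} (S : Matrix (Fin d) (Fin d) ℝ) (ν : Measure ℝ) : Measure (E d) :=
  (covLaw S ν).map fun z => (√(effDim S) * ‖z‖⁻¹) • z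

/-- The input law in each of the two models. -/
def inputLaw (model : InputModel) {d : ℕ} (S : Matrix (Fin d) (Fin d) ℝ) (ν : Measure ℝ) :
    Measure (E d) :=
  match model with
  | .cov => covLaw S ν
  | .sphere => sphereLaw S ν

/-! ### Kernels -/

/-- The rotationally invariant kernel `g(‖x‖²/τ, ‖x'‖²/τ, ⟨x, x'⟩/τ)` at scale `τ`. -/
def scaledKernel (g : ℝ → ℝ → ℝ → ℝ) (τ : ℝ) {d : ℕ} (x x' : E d) : ℝ :=
  g (‖x‖ ^ 2 / τ) (‖x'‖ ^ 2 / τ) (inner ℝ x x' / τ)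

/-- Finite expansion of order `q` near the unit sphere: `g(s,t,u) = ∑_{j ≤ q} g_j(s,t) u^j +
u^{q+1} r(s,t,u)` for `s, t` near `1` and `u` near `0`, with `g_j` of class `C^{q+1-j}` in a
neighbourhood of `(1,1)` and `r` continuous in a neighbourhood of `(1,1,0)`. -/
def HasExpansion (q : ℕ) (g : ℝ → ℝ → ℝ → ℝ) : Prop :=
  ∃ δ > 0, ∃ δ' > 0, ∃ (gj : ℕ → ℝ × ℝ → ℝ) (r : ℝ × ℝ × ℝ → ℝ),
    (∀ s ∈ Set.Icc (1 - δ) (1 + δ), ∀ t ∈ Set.Icc (1 - δ) (1 + δ), ∀ u ∈ Set.Icc (-δ') δ',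
      g s t u = ∑ j ∈ Finset.range (q + 1), gj j (s, t) * u ^ j + u ^ (q + 1) * r (s, t, u)) ∧
    (∀ j ≤ q, ∃ U ∈ 𝓝 ((1 : ℝ), (1 : ℝ)), ContDiffOn ℝ ((q + 1 - j : ℕ) : ℕ∞) (gj j) U) ∧
    (∃ U ∈ 𝓝 ((1 : ℝ), (1 : ℝ), (0 : ℝ)), ContinuousOn r U)

/-- The same expansion for the restriction of the kernel to the unit sphere, i.e. only for
`s = t = 1`; the coefficients `g_j(1,1)` are then numbers. -/
def HasSphereExpansion (q : ℕ) (g : ℝ → ℝ → ℝ → ℝ) : Prop :=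
  ∃ δ' > 0, ∃ (a : ℕ → ℝ) (r : ℝ → ℝ),
    (∀ u ∈ Set.Icc (-δ') δ',
      g 1 1 u = ∑ j ∈ Finset.range (q + 1), a j * u ^ j + u ^ (q + 1) * r u) ∧
    (∃ U ∈ 𝓝 (0 : ℝ), ContinuousOn r U)

/-- The kernel, respectively its restriction to the unit sphere, has an expansion of order
`⌊2/β⌋`. -/
def ExpansionAssumption (model : InputModel) (β : ℝ) (g : ℝ → ℝ → ℝ → ℝ) : Prop :=
  match model with
  | .cov => HasExpansion ⌊2 / β⌋₊ g
  | .sphere => HasSphereExpansion ⌊2 / β⌋₊ g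

/-- The degree of the polynomial approximation barrier. -/
def barrierDegree (model : InputModel) (β : ℝ) : ℕ :=
  match model with
  | .cov => 2 * ⌊2 / β⌋₊
  | .sphere => ⌊2 / β⌋₊

/-- Polynomials in `d` variables of (total) degree at most `m`. -/
def polySpace (d m : ℕ) : Set (MvPolynomial (Fin d) ℝ) := {p | p.totalDegree ≤ m}

/-- Evaluation of a polynomial at a point of Euclidean space. -/
def polyEval {d : ℕ} (p : MvPolynomial (Fin d) ℝ) (x : E d) : ℝ :=
  MvPolynomial.eval (fun j => x j) p

/-! ### Estimators -/

section Estimator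

variable {d : ℕ} {𝒳 : Set (E d)} (H : Type*) [NormedAddCommGroup H] [InnerProductSpace ℝ H]
  [RKHS ℝ H 𝒳 ℝ]

/-- `f` is the kernel ridge regression estimate (`lam > 0`), respectively the minimum norm
interpolant (`lam = 0`), for the data `(x i, y i)`. -/
def IsEstimate {n : ℕ} (lam : ℝ) (x : Fin n → 𝒳) (y : Fin n → ℝ) (f : H) : Prop :=
  (0 < lam ∧ ∀ h : H, ∑ i, (y i - f (x i)) ^ 2 + lam * ‖f‖ ^ 2
      ≤ ∑ i, (y i - h (x i)) ^ 2 + lam * ‖h‖ ^ 2) ∨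
  (lam = 0 ∧ (∀ i, f (x i) = y i) ∧ ∀ h : H, (∀ i, h (x i) = y i) → ‖f‖ ≤ ‖h‖)

open Classical in
/-- The kernel estimator; it is `0` if no estimate exists, which can only happen for `lam = 0`
and data that no element of `H` interpolates. -/
def estimator {n : ℕ} (lam : ℝ) (x : Fin n → 𝒳) (y : Fin n → ℝ) : H :=
  if h : ∃ f : H, IsEstimate H lam x y f then h.choose else 0

/-- The estimator averaged over independent responses `y i ∼ P(Y | X = x i)`. -/
def avgEstimator (ρ : Measure (𝒳 × ℝ)) [IsFiniteMeasure ρ] {n : ℕ} (lam : ℝ) (x : Fin n → 𝒳)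
    (z : 𝒳) : ℝ :=
  ∫ y : Fin n → ℝ, estimator H lam x y z ∂(Measure.pi fun i => ρ.condKernel (x i))

end Estimator

/-- The ground truth `f⋆(x) = E[Y | X = x]`. -/
def groundTruth {d : ℕ} {𝒳 : Set (E d)} (ρ : Measure (𝒳 × ℝ)) [IsFiniteMeasure ρ] (x : 𝒳) : ℝ :=
  ∫ y, y ∂(ρ.condKernel x)

/-- The bias `‖E_Y f̂ - f⋆‖²` in `L²(P_X)`, as an extended nonnegative real (it may be infinite). -/
def bias {d : ℕ} {𝒳 : Set (E d)} (H : Type*) [NormedAddCommGroup H] [InnerProductSpace ℝ H]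
    [RKHS ℝ H 𝒳 ℝ] (ρ : Measure (𝒳 × ℝ)) [IsFiniteMeasure ρ] {n : ℕ} (lam : ℝ)
    (x : Fin n → 𝒳) : ℝ≥0∞ :=
  eLpNorm (fun z => avgEstimator H ρ lam x z - groundTruth ρ z) 2 ρ.fst ^ 2

/-- The empirical kernel matrix. -/
def kernelMatrix {d : ℕ} {𝒳 : Set (E d)} (g : ℝ → ℝ → ℝ → ℝ) (τ : ℝ) {n : ℕ} (x : Fin n → 𝒳) :
    Matrix (Fin n) (Fin n) ℝ :=
  Matrix.of fun i j => scaledKernel g τ (x i : E d) (x j : E d)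

end PolyBarrier

end

/-! The averaged estimator is linear in the ground truth:
`E_Y f̂ = ∑ i, w i • k(x i, ·)` with `w = (K + λ I)⁻¹ f⋆(𝐗)`. If the eigenvalues of `K + λ I` are
at least `c`, then `∑ i, |w i| ≤ n B / c`, so an approximation of `z ↦ k(x i, z)` by polynomials,
uniform in `i` and with error `o(1 / n)`, suffices.

By the Hanson–Wright inequality for `‖x‖²` and sub-Gaussian tails for `⟨x i, x⟩`, conditionally on
the data, `‖x‖² / τ - 1` and `⟨x i, x⟩ / τ` are at most `n ^ (-b)` for any `b < β / 2`, outside a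
set of stretched-exponentially small probability. Choosing `b (⌊2 / β⌋ + 1) > 1` makes the Taylor
remainder of order `⌊2 / β⌋ + 1` of the kernel `o(1 / n)`. In a test point `⟨x i, x⟩` has degree one
and `‖x‖²` degree two, whence the degree `2 ⌊2 / β⌋` in the covariance model; on the sphere `‖x‖²`
is constant.

The estimator and the polynomial need not be close on the exceptional set. The bias bound survives
because the `L⁴` norm of the polynomial grows only linearly in `n` and `f⋆` is bounded, so `f⋆ - p`
is negligible there, whatever the estimator does.
-/

noncomputable section

namespace PolyBarrier

open scoped NNReal

/-- The exponential moment `E[exp f]` with values in `[0, ∞]`, so that it can be bounded, and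
Tonelli's theorem applied to it, before integrability is known. -/
def expMoment {α : Type*} [MeasurableSpace α] (P : Measure α) (f : α → ℝ) : ℝ≥0∞ :=
  ∫⁻ x, ENNReal.ofReal (Real.exp (f x)) ∂P

section ExpMoment

variable {α : Type*} [MeasurableSpace α] {P : Measure α}

lemma expMoment_mono_ae {f g : α → ℝ} (h : f ≤ᵐ[P] g) : expMoment P f ≤ expMoment P g :=
  lintegral_mono_ae <| h.mono fun _ hx => ENNReal.ofReal_le_ofReal (Real.exp_le_exp.2 hx)

lemma expMoment_eq_ofReal_integral {f : α → ℝ} (hf : Integrable (fun x => Real.exp (f x)) P) :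
    expMoment P f = ENNReal.ofReal (∫ x, Real.exp (f x) ∂P) :=
  (ofReal_integral_eq_lintegral_ofReal hf (ae_of_all _ fun _ => (Real.exp_pos _).le)).symm

lemma expMoment_const_add {f : α → ℝ} (hf : Measurable f) (c : ℝ) :
    expMoment P (fun x => c + f x) = ENNReal.ofReal (Real.exp c) * expMoment P f := by
  simp_rw [expMoment, Real.exp_add, ENNReal.ofReal_mul (Real.exp_pos _).le]
  exact lintegral_const_mul _ (by fun_prop)

lemma expMoment_map {β : Type*} [MeasurableSpace β] {φ : α → β} (hφ : Measurable φ) {f : β → ℝ}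
    (hf : Measurable f) : expMoment (P.map φ) f = expMoment P (fun x => f (φ x)) :=
  lintegral_map (by fun_prop) hφ

lemma measure_le_of_expMoment_le {f : α → ℝ} (hf : Measurable f) {K : ℝ≥0∞}
    (h : expMoment P f ≤ K) (y : ℝ) :
    P {x | y ≤ f x} ≤ K * ENNReal.ofReal (Real.exp (-y)) := by
  have hy : ENNReal.ofReal (Real.exp y) ≠ 0 := (ENNReal.ofReal_pos.2 (Real.exp_pos y)).ne'
  calc P {x | y ≤ f x}
      ≤ P {x | ENNReal.ofReal (Real.exp y) ≤ ENNReal.ofReal (Real.exp (f x))} :=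
        measure_mono fun _ hx => ENNReal.ofReal_le_ofReal (Real.exp_le_exp.2 hx)
    _ ≤ expMoment P f / ENNReal.ofReal (Real.exp y) :=
        meas_ge_le_lintegral_div (by fun_prop) hy ENNReal.ofReal_ne_top
    _ ≤ K * ENNReal.ofReal (Real.exp (-y)) := by
        rw [div_eq_mul_inv, ← ENNReal.ofReal_inv_of_pos (Real.exp_pos y), ← Real.exp_neg]
        gcongr

lemma measure_le_abs_le_of_expMoment_le {f : α → ℝ} (hf : Measurable f) {θ : ℝ} (hθ : 0 < θ)
    {K : ℝ≥0∞} (h : expMoment P (fun x => θ * f x) ≤ K)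
    (h' : expMoment P (fun x => -θ * f x) ≤ K) (y : ℝ) :
    P {x | y ≤ |f x|} ≤ 2 * K * ENNReal.ofReal (Real.exp (-(θ * y))) := by
  have hsub : {x | y ≤ |f x|} ⊆ {x | θ * y ≤ θ * f x} ∪ {x | θ * y ≤ -θ * f x} := by
    intro x hx
    rcases le_abs.1 (show y ≤ |f x| from hx) with hy | hy
    · exact Or.inl (mul_le_mul_of_nonneg_left hy hθ.le)
    · refine Or.inr ?_
      change θ * y ≤ -θ * f x
      rw [neg_mul, ← mul_neg]
      exact mul_le_mul_of_nonneg_left hy hθ.le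
  refine (measure_mono hsub).trans ((measure_union_le _ _).trans ?_)
  rw [mul_assoc, two_mul]
  exact add_le_add (measure_le_of_expMoment_le (by fun_prop) h _)
    (measure_le_of_expMoment_le (by fun_prop) h' _)

-- Jensen's inequality for `exp`.
lemma expMoment_sum_mul_le {κ : Type*} [Fintype κ] {w : κ → ℝ} (hw : ∀ k, 0 ≤ w k)
    (hw1 : ∑ k, w k = 1) {f : κ → α → ℝ} (hf : ∀ k, Measurable (f k)) {K : ℝ≥0∞}
    (h : ∀ k, w k ≠ 0 → expMoment P (f k) ≤ K) :
    expMoment P (fun x => ∑ k, w k * f k x) ≤ K := by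
  have jensen (x : α) : ENNReal.ofReal (Real.exp (∑ k, w k * f k x)) ≤
      ∑ k, ENNReal.ofReal (w k) * ENNReal.ofReal (Real.exp (f k x)) := by
    simp_rw [← ENNReal.ofReal_mul (hw _)]
    rw [← ENNReal.ofReal_sum_of_nonneg fun k _ => mul_nonneg (hw k) (Real.exp_pos _).le]
    exact ENNReal.ofReal_le_ofReal
      (convexOn_exp.map_sum_le (fun k _ => hw k) hw1 fun k _ => Set.mem_univ (f k x))
  calc expMoment P (fun x => ∑ k, w k * f k x)
      ≤ ∫⁻ x, ∑ k, ENNReal.ofReal (w k) * ENNReal.ofReal (Real.exp (f k x)) ∂P :=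
        lintegral_mono jensen
    _ = ∑ k, ENNReal.ofReal (w k) * expMoment P (f k) := by
        rw [lintegral_finsetSum _ fun k _ => by fun_prop]
        exact Finset.sum_congr rfl fun k _ => lintegral_const_mul _ (by fun_prop)
    _ ≤ ∑ k, ENNReal.ofReal (w k) * K := by
        refine Finset.sum_le_sum fun k _ => ?_
        rcases eq_or_ne (w k) 0 with hk | hk
        · simp [hk]
        · gcongr
          exact h k hk
    _ = K := by
        rw [← Finset.sum_mul, ← ENNReal.ofReal_sum_of_nonneg fun k _ => hw k, hw1,
          ENNReal.ofReal_one, one_mul]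

lemma expMoment_pi_sum {ι : Type*} [Fintype ι] {ν : ι → Measure ℝ}
    [∀ i, IsProbabilityMeasure (ν i)] {f : ι → ℝ → ℝ} (hf : ∀ i, Measurable (f i)) :
    expMoment (Measure.pi ν) (fun w => ∑ i, f i (w i)) = ∏ i, expMoment (ν i) (f i) := by
  have hexp (i : ι) : Measurable fun w : ℝ => ENNReal.ofReal (Real.exp (f i w)) := by fun_prop
  simp_rw [expMoment, Real.exp_sum, ENNReal.ofReal_prod_of_nonneg fun _ _ => (Real.exp_pos _).le]
  rw [lintegral_prod_eq_prod_lintegral_of_indepFun Finset.univ _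
    (iIndepFun_pi fun i => (hexp i).aemeasurable) fun i => by fun_prop]
  exact Finset.prod_congr rfl fun i _ => (measurePreserving_eval ν i).lintegral_comp (hexp i)

end ExpMoment

section Subgaussian

variable {α : Type*} [MeasurableSpace α] {P : Measure α} {X : α → ℝ} {v : ℝ≥0}

lemma expMoment_const_mul_le (h : HasSubgaussianMGF X v P) (t : ℝ) :
    expMoment P (fun x => t * X x) ≤ ENNReal.ofReal (Real.exp (v * t ^ 2 / 2)) := by
  rw [expMoment_eq_ofReal_integral (h.integrable_exp_mul t)]
  exact ENNReal.ofReal_le_ofReal (h.mgf_le t)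

lemma measure_le_abs_le_of_hasSubgaussianMGF (h : HasSubgaussianMGF X v P) (hX : Measurable X)
    {θ : ℝ} (hθ : 0 < θ) (y : ℝ) :
    P {x | y ≤ |X x|} ≤
      2 * ENNReal.ofReal (Real.exp (v * θ ^ 2 / 2)) * ENNReal.ofReal (Real.exp (-(θ * y))) :=
  measure_le_abs_le_of_expMoment_le hX hθ (expMoment_const_mul_le h θ)
    ((expMoment_const_mul_le h (-θ)).trans_eq (by rw [neg_sq])) y

lemma expMoment_volume_mul_sub_mul_sq {b : ℝ} (hb : 0 < b) (c : ℝ) :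
    expMoment volume (fun t : ℝ => t * c - b * t ^ 2) =
      ENNReal.ofReal (√(Real.pi / b)) * ENNReal.ofReal (Real.exp (c ^ 2 / (4 * b))) := by
  have complete_square (t : ℝ) : Real.exp (t * c - b * t ^ 2) =
      Real.exp (-b * (t - c / (2 * b)) ^ 2) * Real.exp (c ^ 2 / (4 * b)) := by
    rw [← Real.exp_add]
    congr 1
    field_simp
    ring
  have hintegrable : Integrable fun t : ℝ => Real.exp (t * c - b * t ^ 2) := by
    simp_rw [complete_square]
    exact ((integrable_exp_neg_mul_sq hb).comp_sub_right _).mul_const _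
  rw [expMoment_eq_ofReal_integral hintegrable, ← ENNReal.ofReal_mul (Real.sqrt_nonneg _)]
  simp_rw [complete_square]
  rw [integral_mul_const, integral_sub_right_eq_self (fun t => Real.exp (-b * t ^ 2)),
    integral_gaussian]

-- `exp (X² / (4v))` is a Gaussian average over `t` of `exp (t X)`; then Tonelli.
lemma expMoment_sq_le (h : HasSubgaussianMGF X v P) (hX : Measurable X) (hv : 0 < v) [SFinite P] :
    expMoment P (fun x => X x ^ 2 / (4 * v)) ≤ 2 := by
  have hv' : (0 : ℝ) < v := hv
  set c := ENNReal.ofReal (√(Real.pi / v)) with hc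
  have hc0 : c ≠ 0 := (ENNReal.ofReal_pos.2 (by positivity)).ne'
  have hsqrt : √(Real.pi / (v / 2)) ≤ √(Real.pi / v) * 2 := by
    rw [Real.sqrt_le_left (by positivity), mul_pow, Real.sq_sqrt (by positivity)]
    have : 0 < Real.pi / v := by positivity
    have : Real.pi / (v / 2) = 2 * (Real.pi / v) := by field_simp
    linarith
  have hinner (t : ℝ) : expMoment P (fun x => t * X x - v * t ^ 2) ≤
      ENNReal.ofReal (Real.exp (t * 0 - v / 2 * t ^ 2)) := by
    simp_rw [sub_eq_neg_add]
    rw [expMoment_const_add (by fun_prop)]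
    refine (mul_le_mul_right (expMoment_const_mul_le h t) _).trans_eq ?_
    rw [← ENNReal.ofReal_mul (Real.exp_pos _).le, ← Real.exp_add]
    ring_nf
  refine (ENNReal.mul_le_mul_iff_right hc0 ENNReal.ofReal_ne_top).1 ?_
  calc c * expMoment P (fun x => X x ^ 2 / (4 * v))
      = ∫⁻ x, expMoment volume (fun t : ℝ => t * X x - v * t ^ 2) ∂P := by
        simp_rw [expMoment_volume_mul_sub_mul_sq hv']
        exact (lintegral_const_mul _ (by fun_prop)).symm
    _ = ∫⁻ t : ℝ, expMoment P (fun x => t * X x - v * t ^ 2) :=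
        lintegral_lintegral_swap (by fun_prop)
    _ ≤ expMoment volume (fun t : ℝ => t * 0 - v / 2 * t ^ 2) := lintegral_mono hinner
    _ = ENNReal.ofReal (√(Real.pi / (v / 2))) := by
        rw [expMoment_volume_mul_sub_mul_sq (half_pos hv')]
        simp
    _ ≤ c * 2 := by
        rw [hc, ← ENNReal.ofReal_ofNat, ← ENNReal.ofReal_mul (Real.sqrt_nonneg _)]
        exact ENNReal.ofReal_le_ofReal hsqrt

-- No independence is assumed: Jensen's inequality with weights `v k / ∑ v`.
lemma expMoment_sum_sq_le [IsProbabilityMeasure P] {κ : Type*} [Fintype κ] {X : κ → α → ℝ}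
    {v : κ → ℝ≥0} (h : ∀ k, HasSubgaussianMGF (X k) (v k) P) (hX : ∀ k, Measurable (X k))
    {s : ℝ} (hs : 4 * s * ∑ k, (v k : ℝ) ≤ 1) :
    expMoment P (fun x => s * ∑ k, X k x ^ 2) ≤ 2 := by
  set V : ℝ := ∑ k, (v k : ℝ)
  have hzero : ∀ᵐ x ∂P, ∀ k, v k = 0 → X k x = 0 :=
    ae_all_iff.2 fun k => by
      by_cases hk : v k = 0
      · filter_upwards [(hk ▸ h k).ae_eq_zero_of_hasSubgaussianMGF_zero] with x hx _ using hx
      · exact ae_of_all _ fun x hk' => absurd hk' hk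
  rcases (Finset.sum_nonneg fun k _ => (v k).coe_nonneg : 0 ≤ V).eq_or_lt' with hV0 | hVpos
  · have hv0 (k : κ) : v k = 0 :=
      NNReal.coe_eq_zero.1 ((Finset.sum_eq_zero_iff_of_nonneg fun k _ => (v k).coe_nonneg).1 hV0 k
        (Finset.mem_univ k))
    calc expMoment P (fun x => s * ∑ k, X k x ^ 2) ≤ expMoment P (fun _ => 0) :=
          expMoment_mono_ae <| hzero.mono fun x hx => by simp [hx _ (hv0 _)]
      _ ≤ 2 := by simp [expMoment]
  · refine (expMoment_mono_ae ?_).trans (expMoment_sum_mul_le (w := fun k => v k / V)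
      (f := fun k x => X k x ^ 2 / (4 * v k)) (K := 2) (fun k => by positivity)
      (by rw [← Finset.sum_div, div_self hVpos.ne']) (fun k => by have := hX k; fun_prop)
      fun k hk => expMoment_sq_le (h k) (hX k) (pos_iff_ne_zero.2 fun h0 => hk (by simp [h0])))
    filter_upwards [hzero] with x hx
    rw [Finset.mul_sum]
    refine Finset.sum_le_sum fun k _ => ?_
    rcases eq_or_ne (v k) 0 with h0 | h0
    · simp [h0, hx k h0]
    · have : (0 : ℝ) < v k := by positivity
      calc s * X k x ^ 2 ≤ 1 / (4 * V) * X k x ^ 2 := by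
            gcongr
            rw [le_div_iff₀ (by positivity)]
            linarith
        _ = v k / V * (X k x ^ 2 / (4 * v k)) := by field_simp

lemma exp_le_one_add_add_sq_mul_exp_abs (x : ℝ) :
    Real.exp x ≤ 1 + x + x ^ 2 * Real.exp |x| := by
  have h1 : 1 ≤ Real.exp |x| := Real.one_le_exp (abs_nonneg x)
  rcases le_or_gt |x| 1 with hx | hx
  · have := (abs_le.1 (Real.abs_exp_sub_one_sub_id_le hx)).2
    nlinarith [sq_nonneg x]
  · rcases lt_abs.1 hx with h | h
    · rw [abs_of_pos (by linarith)] at *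
      nlinarith [mul_le_mul_of_nonneg_right (show 1 ≤ x ^ 2 by nlinarith) (Real.exp_pos x).le]
    · have : Real.exp x ≤ 1 := Real.exp_le_one_iff.2 (by linarith)
      nlinarith [mul_le_mul_of_nonneg_left h1 (sq_nonneg x)]

lemma sq_le_mul_exp {c y : ℝ} (hc : 0 < c) (hy : 0 ≤ y) :
    y ^ 2 ≤ 2 * c ^ 2 * Real.exp (y / c) := by
  have hyc : 0 ≤ y / c := by positivity
  calc y ^ 2 = 2 * c ^ 2 * ((y / c) ^ 2 / 2) := by field_simp
    _ ≤ 2 * c ^ 2 * Real.exp (y / c) := by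
        gcongr
        linarith [Real.quadratic_le_exp_of_nonneg hyc]

lemma exp_mul_sq_sub_one_le {v s : ℝ} (hv : 0 < v) (hs : |s| ≤ 1 / (8 * v)) (w : ℝ) :
    Real.exp (s * (w ^ 2 - 1)) ≤ 1 + s * (w ^ 2 - 1) +
      128 * v ^ 2 * Real.exp (1 / (4 * v)) * s ^ 2 * Real.exp (w ^ 2 / (4 * v)) := by
  refine (exp_le_one_add_add_sq_mul_exp_abs _).trans (add_le_add_right ?_ _)
  set y := w ^ 2 + 1 with hy
  have hwy : |w ^ 2 - 1| ≤ y := abs_le.2 ⟨by nlinarith [sq_nonneg w], by linarith⟩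
  have habs : |s * (w ^ 2 - 1)| ≤ y / (8 * v) := by
    rw [abs_mul, ← one_div_mul_eq_div]
    gcongr
  have hsq : (s * (w ^ 2 - 1)) ^ 2 ≤ s ^ 2 * (2 * (8 * v) ^ 2 * Real.exp (y / (8 * v))) := by
    rw [mul_pow]
    gcongr
    exact (sq_le_sq.2 (hwy.trans (le_abs_self y))).trans
      (sq_le_mul_exp (by positivity) (by positivity))
  calc (s * (w ^ 2 - 1)) ^ 2 * Real.exp |s * (w ^ 2 - 1)|
      ≤ s ^ 2 * (2 * (8 * v) ^ 2 * Real.exp (y / (8 * v))) * Real.exp (y / (8 * v)) := by gcongr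
    _ = 128 * v ^ 2 * s ^ 2 * Real.exp (y / (8 * v) + y / (8 * v)) := by rw [Real.exp_add]; ring
    _ = 128 * v ^ 2 * s ^ 2 * Real.exp (1 / (4 * v) + w ^ 2 / (4 * v)) := by
        rw [hy]
        congr 2
        field_simp
        ring
    _ = _ := by rw [Real.exp_add]; ring

lemma expMoment_mul_sq_sub_one_le [IsProbabilityMeasure P] (h : HasSubgaussianMGF X v P)
    (hX : Measurable X) (hv : 0 < v) (hX2 : ∫ x, X x ^ 2 ∂P = 1) {s : ℝ}
    (hs : |s| ≤ 1 / (8 * v)) :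
    expMoment P (fun x => s * (X x ^ 2 - 1)) ≤
      ENNReal.ofReal (Real.exp (256 * v ^ 2 * Real.exp (1 / (4 * v)) * s ^ 2)) := by
  set D : ℝ := 128 * v ^ 2 * Real.exp (1 / (4 * v)) with hD
  have hfin : expMoment P (fun x => X x ^ 2 / (4 * v)) ≤ 2 := expMoment_sq_le h hX hv
  have hexp : Integrable (fun x => Real.exp (X x ^ 2 / (4 * v))) P :=
    (lintegral_ofReal_ne_top_iff_integrable (by fun_prop)
      (ae_of_all _ fun _ => (Real.exp_pos _).le)).1 (ne_top_of_le_ne_top (by simp) hfin)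
  have hexp_le : ∫ x, Real.exp (X x ^ 2 / (4 * v)) ∂P ≤ 2 := by
    rw [expMoment_eq_ofReal_integral hexp] at hfin
    exact (ENNReal.ofReal_le_ofReal_iff zero_le_two).1 (by simpa using hfin)
  have hsq : Integrable (fun x => X x ^ 2) P := .of_integral_ne_zero (by simp [hX2])
  have hlin : Integrable (fun x => 1 + s * (X x ^ 2 - 1)) P := by fun_prop
  have hrem : Integrable (fun x => D * s ^ 2 * Real.exp (X x ^ 2 / (4 * v))) P :=
    hexp.const_mul _
  have hsum : Integrable (fun x => 1 + s * (X x ^ 2 - 1) +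
      D * s ^ 2 * Real.exp (X x ^ 2 / (4 * v))) P := hlin.add hrem
  have hle (x : α) := exp_mul_sq_sub_one_le (NNReal.coe_pos.2 hv) hs (X x)
  calc expMoment P (fun x => s * (X x ^ 2 - 1))
      ≤ ∫⁻ x, ENNReal.ofReal
          (1 + s * (X x ^ 2 - 1) + D * s ^ 2 * Real.exp (X x ^ 2 / (4 * v))) ∂P :=
        lintegral_mono fun x => ENNReal.ofReal_le_ofReal (hle x)
    _ = ENNReal.ofReal (1 + D * s ^ 2 * ∫ x, Real.exp (X x ^ 2 / (4 * v)) ∂P) := by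
        rw [← ofReal_integral_eq_lintegral_ofReal hsum
          (ae_of_all _ fun x => (Real.exp_pos _).le.trans (hle x)), integral_add hlin hrem,
          integral_add (by fun_prop) (by fun_prop), integral_const_mul, integral_const_mul,
          integral_sub hsq (by fun_prop), hX2]
        simp
    _ ≤ ENNReal.ofReal (Real.exp (256 * v ^ 2 * Real.exp (1 / (4 * v)) * s ^ 2)) := by
        refine ENNReal.ofReal_le_ofReal (le_trans ?_ (Real.add_one_le_exp _))
        have : D * s ^ 2 * ∫ x, Real.exp (X x ^ 2 / (4 * v)) ∂P ≤ D * s ^ 2 * 2 := by gcongr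
        rw [hD] at this ⊢
        linarith

end Subgaussian

section QuadraticForm

variable {ι : Type*} [Fintype ι] {ν : ι → Measure ℝ} [∀ i, IsProbabilityMeasure (ν i)] {v : ℝ≥0}

lemma hasSubgaussianMGF_sum_mul (hν : ∀ i, HasSubgaussianMGF (fun w => w) v (ν i)) (a : ι → ℝ) :
    HasSubgaussianMGF (fun w => ∑ i, a i * w i) (v * ∑ i, ‖a i‖₊ ^ 2) (Measure.pi ν) := by
  have hindep : iIndepFun (fun i (w : ι → ℝ) => a i * w i) (Measure.pi ν) :=
    iIndepFun_pi (X := fun i w => a i * w) fun i => by fun_prop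
  have hterm (i : ι) : HasSubgaussianMGF (fun w => a i * w i) (‖a i‖₊ ^ 2 * v) (Measure.pi ν) := by
    have heval : HasSubgaussianMGF (fun w => w) v ((Measure.pi ν).map (Function.eval i)) := by
      rw [(measurePreserving_eval ν i).map_eq]
      exact hν i
    have hscale := (heval.of_map (measurePreserving_eval ν i).aemeasurable).const_mul (a i)
    rwa [show (⟨a i ^ 2, sq_nonneg _⟩ : ℝ≥0) = ‖a i‖₊ ^ 2 from
      NNReal.eq (sq_abs (a i)).symm] at hscale
  rw [Finset.mul_sum]
  convert HasSubgaussianMGF.sum_of_iIndepFun hindep (s := Finset.univ) fun i _ => hterm i using 1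
  simp_rw [mul_comm v]

-- The linear form in the first argument is integrated out first.
lemma expMoment_prod_sum_mul_le {κ : Type*} [Fintype κ] {ν' : κ → Measure ℝ}
    [∀ j, IsProbabilityMeasure (ν' j)] (hν : ∀ i, HasSubgaussianMGF (fun w => w) v (ν i))
    (hν' : ∀ j, HasSubgaussianMGF (fun w => w) v (ν' j)) {A : ι → κ → ℝ}
    (hA : 2 * (v : ℝ) ^ 2 * ∑ i, ∑ j, A i j ^ 2 ≤ 1) :
    expMoment ((Measure.pi ν).prod (Measure.pi ν'))
      (fun z => ∑ i, ∑ j, A i j * (z.1 i * z.2 j)) ≤ 2 := by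
  have hlin (z : κ → ℝ) : expMoment (Measure.pi ν) (fun w => ∑ i, ∑ j, A i j * (w i * z j)) ≤
      ENNReal.ofReal (Real.exp (v / 2 * ∑ i, (∑ j, A i j * z j) ^ 2)) := by
    convert expMoment_const_mul_le (hasSubgaussianMGF_sum_mul hν fun i => ∑ j, A i j * z j) 1
      using 2
    · funext w
      rw [one_mul]
      refine Finset.sum_congr rfl fun i _ => ?_
      rw [Finset.sum_mul]
      exact Finset.sum_congr rfl fun j _ => by ring
    · simp
      ring
  calc expMoment ((Measure.pi ν).prod (Measure.pi ν'))
        (fun z => ∑ i, ∑ j, A i j * (z.1 i * z.2 j))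
      = ∫⁻ z, expMoment (Measure.pi ν) (fun w => ∑ i, ∑ j, A i j * (w i * z j))
          ∂(Measure.pi ν') := lintegral_prod_symm' _ (by fun_prop)
    _ ≤ expMoment (Measure.pi ν') (fun z => v / 2 * ∑ i, (∑ j, A i j * z j) ^ 2) :=
        lintegral_mono hlin
    _ ≤ 2 := by
        refine expMoment_sum_sq_le (fun i => hasSubgaussianMGF_sum_mul hν' (A i))
          (fun i => by fun_prop) ?_
        simp only [NNReal.coe_mul, NNReal.coe_sum, NNReal.coe_pow, coe_nnnorm, Real.norm_eq_abs,
          sq_abs, ← Finset.mul_sum]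
        linarith

lemma expMoment_sum_product_compl_le [DecidableEq ι]
    (hν : ∀ i, HasSubgaussianMGF (fun w => w) v (ν i)) {A : ι → ι → ℝ}
    (hA : 2 * (v : ℝ) ^ 2 * ∑ i, ∑ j, A i j ^ 2 ≤ 1) (I : Finset ι) :
    expMoment (Measure.pi ν) (fun w => ∑ p ∈ I ×ˢ Iᶜ, A p.1 p.2 * (w p.1 * w p.2)) ≤ 2 := by
  have hsplit (f : ι → ι → ℝ) : ∑ p ∈ I ×ˢ Iᶜ, f p.1 p.2 =
      ∑ i : {i // i ∈ I}, ∑ j : {j // j ∉ I}, f i j := by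
    rw [Finset.sum_product, Finset.sum_subtype I fun _ => Iff.rfl]
    exact Finset.sum_congr rfl fun i _ => Finset.sum_subtype Iᶜ (fun _ => Finset.mem_compl) _
  have hsum : ∑ i : {i // i ∈ I}, ∑ j : {j // j ∉ I}, A i j ^ 2 ≤ ∑ i, ∑ j, A i j ^ 2 := by
    rw [← hsplit fun i j => A i j ^ 2, ← Finset.sum_product']
    exact Finset.sum_le_sum_of_subset_of_nonneg (Finset.subset_univ _) fun _ _ _ => sq_nonneg _
  simp_rw [fun w : ι → ℝ => hsplit fun i j => A i j * (w i * w j)]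
  have hmp := measurePreserving_piEquivPiSubtypeProd ν (· ∈ I)
  refine (hmp.lintegral_comp (f := fun z => ENNReal.ofReal (Real.exp
    (∑ i : {i // i ∈ I}, ∑ j : {j // j ∉ I}, A i j * (z.1 i * z.2 j)))) (by fun_prop)).trans_le ?_
  convert! expMoment_prod_sum_mul_le (fun i : {i // i ∈ I} => hν i)
    (fun j : {j // j ∉ I} => hν j) (hA.trans' (by gcongr)) using 1
  simp only [expMoment]
  congr!

-- Each off-diagonal pair lies in `I ×ˢ Iᶜ` for exactly a quarter of all `I`.
lemma two_pow_card_mul_sum_offDiag [DecidableEq ι] (f : ι × ι → ℝ) :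
    (2 : ℝ) ^ Fintype.card ι * ∑ p ∈ Finset.univ.offDiag, f p =
      4 * ∑ I : Finset ι, ∑ p ∈ I ×ˢ Iᶜ, f p := by
  have hswap : ∑ I : Finset ι, ∑ p ∈ I ×ˢ Iᶜ, f p =
      ∑ p ∈ Finset.univ.offDiag, ∑ _I ∈ Finset.Icc ({p.1} : Finset ι) {p.2}ᶜ, f p := by
    refine Finset.sum_comm' fun I p => ?_
    simp only [Finset.mem_univ, true_and, Finset.mem_product, Finset.mem_compl, Finset.mem_Icc,
      Finset.singleton_subset_iff, Finset.mem_offDiag,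
      Finset.subset_compl_singleton]
    exact ⟨fun h => ⟨h, fun e => h.2 (e ▸ h.1)⟩, And.left⟩
  rw [hswap, Finset.mul_sum, Finset.mul_sum]
  refine Finset.sum_congr rfl fun p hp => ?_
  have hne : p.1 ≠ p.2 := (Finset.mem_offDiag.1 hp).2.2
  obtain ⟨m, hm⟩ := Nat.exists_eq_add_of_le' (Fintype.one_lt_card_iff.2 ⟨p.1, p.2, hne⟩)
  rw [Finset.sum_const, Finset.card_Icc_finset (by simpa using hne.symm), Finset.card_compl,
    Finset.card_singleton, Finset.card_singleton, hm, nsmul_eq_mul, ← mul_assoc,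
    show m + Nat.succ 1 - 1 - 1 = m by omega]
  push_cast
  ring

-- Decoupling: the form is an average over `I` of bilinear forms in independent arguments.
lemma expMoment_sum_offDiag_le (hν : ∀ i, HasSubgaussianMGF (fun w => w) v (ν i))
    {A : ι → ι → ℝ} {θ : ℝ}
    (hA : 32 * (v : ℝ) ^ 2 * θ ^ 2 * ∑ i, ∑ j, A i j ^ 2 ≤ 1) :
    expMoment (Measure.pi ν)
      (fun w => θ * ∑ p ∈ Finset.univ.offDiag, A p.1 p.2 * (w p.1 * w p.2)) ≤ 2 := by
  classical
  have hdecouple (w : ι → ℝ) : θ * ∑ p ∈ Finset.univ.offDiag, A p.1 p.2 * (w p.1 * w p.2) =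
      ∑ I : Finset ι, (1 / 2 ^ Fintype.card ι) *
        ∑ p ∈ I ×ˢ Iᶜ, (4 * θ * A p.1 p.2) * (w p.1 * w p.2) := by
    have h := two_pow_card_mul_sum_offDiag fun p => A p.1 p.2 * (w p.1 * w p.2)
    simp_rw [mul_assoc (4 * θ), ← Finset.mul_sum]
    rw [one_div, eq_inv_mul_iff_mul_eq₀ (by positivity)]
    linear_combination θ * h
  simp_rw [hdecouple]
  refine expMoment_sum_mul_le (fun _ => by positivity) (by simp) (fun _ => by fun_prop)
    fun I _ => expMoment_sum_product_compl_le hν (A := fun i j => 4 * θ * A i j) ?_ I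
  simp_rw [mul_pow, ← Finset.mul_sum]
  linarith

lemma expMoment_sum_mul_sq_sub_one_le (hν : ∀ i, HasSubgaussianMGF (fun w => w) v (ν i))
    (hv : 0 < v) (hν2 : ∀ i, ∫ w, w ^ 2 ∂(ν i) = 1) {a : ι → ℝ}
    (ha : ∀ i, |a i| ≤ 1 / (8 * v)) :
    expMoment (Measure.pi ν) (fun w => ∑ i, a i * (w i ^ 2 - 1)) ≤
      ENNReal.ofReal (Real.exp (256 * v ^ 2 * Real.exp (1 / (4 * v)) * ∑ i, a i ^ 2)) := by
  rw [expMoment_pi_sum (f := fun i w => a i * (w ^ 2 - 1)) fun i => by fun_prop, Finset.mul_sum,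
    Real.exp_sum, ENNReal.ofReal_prod_of_nonneg fun i _ => (Real.exp_pos _).le]
  exact Finset.prod_le_prod' fun i _ =>
    expMoment_mul_sq_sub_one_le (hν i) measurable_id hv (hν2 i) (ha i)

/-- The constant in the Hanson–Wright inequality `measure_quadForm_sub_trace_le`. -/
def hansonWrightConst (v : ℝ) : ℝ := 4 + 2 * Real.exp (4 * Real.exp (1 / (4 * v)))

lemma hansonWrightConst_nonneg (v : ℝ) : 0 ≤ hansonWrightConst v := by
  unfold hansonWrightConst
  positivity

lemma measure_le_abs_sum_offDiag_le (hν : ∀ i, HasSubgaussianMGF (fun w => w) v (ν i))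
    (hv : 0 < v) {A : ι → ι → ℝ} {σ : ℝ}
    (hσ : 0 < σ) (hA : ∑ i, ∑ j, A i j ^ 2 ≤ σ ^ 2) (y : ℝ) :
    Measure.pi ν {w | y ≤ |∑ p ∈ Finset.univ.offDiag, A p.1 p.2 * (w p.1 * w p.2)|} ≤
      ENNReal.ofReal (4 * Real.exp (-(1 / (8 * v * σ) * y))) := by
  have : (0 : ℝ) < v := hv
  have hθA : 32 * (v : ℝ) ^ 2 * (1 / (8 * v * σ)) ^ 2 * ∑ i, ∑ j, A i j ^ 2 ≤ 1 := by
    calc 32 * (v : ℝ) ^ 2 * (1 / (8 * v * σ)) ^ 2 * ∑ i, ∑ j, A i j ^ 2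
        ≤ 32 * (v : ℝ) ^ 2 * (1 / (8 * v * σ)) ^ 2 * σ ^ 2 := by gcongr
      _ = 1 / 2 := by field_simp; norm_num
      _ ≤ 1 := by norm_num
  refine (measure_le_abs_le_of_expMoment_le (by fun_prop) (by positivity)
    (expMoment_sum_offDiag_le hν hθA) (expMoment_sum_offDiag_le hν (by rwa [neg_sq])) y).trans_eq ?_
  rw [ENNReal.ofReal_mul (by norm_num)]
  norm_num

lemma measure_le_abs_sum_mul_sq_sub_one_le (hν : ∀ i, HasSubgaussianMGF (fun w => w) v (ν i))
    (hv : 0 < v) (hν2 : ∀ i, ∫ w, w ^ 2 ∂(ν i) = 1) {a : ι → ℝ} {σ : ℝ} (hσ : 0 < σ)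
    (ha : ∑ i, a i ^ 2 ≤ σ ^ 2) (y : ℝ) :
    Measure.pi ν {w | y ≤ |∑ i, a i * (w i ^ 2 - 1)|} ≤
      ENNReal.ofReal (2 * Real.exp (4 * Real.exp (1 / (4 * v))) *
        Real.exp (-(1 / (8 * v * σ) * y))) := by
  have : (0 : ℝ) < v := hv
  have habs (i : ι) : |a i| ≤ σ :=
    abs_le_of_sq_le_sq ((Finset.single_le_sum (f := fun i => a i ^ 2)
      (fun _ _ => sq_nonneg _) (Finset.mem_univ i)).trans ha) hσ.le
  have hmoment {θ : ℝ} (hθ : |θ| = 1 / (8 * v * σ)) :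
      expMoment (Measure.pi ν) (fun w => θ * ∑ i, a i * (w i ^ 2 - 1)) ≤
        ENNReal.ofReal (Real.exp (4 * Real.exp (1 / (4 * v)))) := by
    simp_rw [Finset.mul_sum, ← mul_assoc]
    refine (expMoment_sum_mul_sq_sub_one_le hν hv hν2 (a := fun i => θ * a i) fun i => ?_).trans ?_
    · rw [abs_mul, hθ]
      calc 1 / (8 * v * σ) * |a i| ≤ 1 / (8 * v * σ) * σ := by gcongr; exact habs i
        _ = 1 / (8 * v) := by field_simp
    · refine ENNReal.ofReal_le_ofReal (Real.exp_le_exp.2 ?_)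
      simp_rw [mul_pow, ← Finset.mul_sum, ← sq_abs θ, hθ]
      calc 256 * (v : ℝ) ^ 2 * Real.exp (1 / (4 * v)) * ((1 / (8 * v * σ)) ^ 2 * ∑ i, a i ^ 2)
          ≤ 256 * (v : ℝ) ^ 2 * Real.exp (1 / (4 * v)) * ((1 / (8 * v * σ)) ^ 2 * σ ^ 2) := by
            gcongr
        _ = 4 * Real.exp (1 / (4 * v)) := by field_simp; norm_num
  have hθ : 0 < 1 / (8 * v * σ) := by positivity
  refine (measure_le_abs_le_of_expMoment_le (by fun_prop) hθ (hmoment (abs_of_pos hθ))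
    (hmoment (by rw [abs_neg, abs_of_pos hθ])) y).trans_eq ?_
  rw [ENNReal.ofReal_mul (by positivity), ENNReal.ofReal_mul (by norm_num), ENNReal.ofReal_ofNat]

lemma dotProduct_mulVec_sub_trace (A : Matrix ι ι ℝ) (w : ι → ℝ) :
    w ⬝ᵥ A *ᵥ w - A.trace = ∑ p ∈ Finset.univ.offDiag, A p.1 p.2 * (w p.1 * w p.2) +
      ∑ i, A i i * (w i ^ 2 - 1) := by
  classical
  have hsum : w ⬝ᵥ A *ᵥ w = ∑ p : ι × ι, A p.1 p.2 * (w p.1 * w p.2) := by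
    simp only [dotProduct, mulVec, Finset.mul_sum, Fintype.sum_prod_type]
    exact Finset.sum_congr rfl fun i _ => Finset.sum_congr rfl fun j _ => by ring
  have hdiag : ∑ p ∈ Finset.univ.diag, A p.1 p.2 * (w p.1 * w p.2) = ∑ i, A i i * w i ^ 2 := by
    simp [Finset.sum_diag, sq]
  rw [hsum, ← Finset.univ_product_univ, ← Finset.diag_union_offDiag,
    Finset.sum_union (Finset.disjoint_diag_offDiag _), hdiag, Matrix.trace]
  simp only [mul_sub, mul_one, Finset.sum_sub_distrib, diag_apply]
  ring

/-- **Hanson–Wright inequality**, at the scale `σ` of the Frobenius norm only. -/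
theorem measure_quadForm_sub_trace_le (hν : ∀ i, HasSubgaussianMGF (fun w => w) v (ν i))
    (hv : 0 < v) (hν2 : ∀ i, ∫ w, w ^ 2 ∂(ν i) = 1) {A : Matrix ι ι ℝ} {σ : ℝ} (hσ : 0 < σ)
    (hA : ∑ i, ∑ j, A i j ^ 2 ≤ σ ^ 2) (x : ℝ) :
    Measure.pi ν {w | x * σ ≤ |w ⬝ᵥ A *ᵥ w - A.trace|} ≤
      ENNReal.ofReal (hansonWrightConst v * Real.exp (-(x / (16 * v)))) := by
  have : (0 : ℝ) < v := hv
  have hdiag : ∑ i, A i i ^ 2 ≤ σ ^ 2 := hA.trans' <| Finset.sum_le_sum fun i _ =>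
    Finset.single_le_sum (f := fun j => A i j ^ 2) (fun _ _ => sq_nonneg _) (Finset.mem_univ i)
  have hsub : {w | x * σ ≤ |w ⬝ᵥ A *ᵥ w - A.trace|} ⊆
      {w | x * σ / 2 ≤ |∑ p ∈ Finset.univ.offDiag, A p.1 p.2 * (w p.1 * w p.2)|} ∪
        {w | x * σ / 2 ≤ |∑ i, A i i * (w i ^ 2 - 1)|} := by
    intro w (hw : x * σ ≤ _)
    rw [dotProduct_mulVec_sub_trace] at hw
    by_contra hcon
    simp only [Set.mem_union, Set.mem_ofPred_eq, not_or, not_le] at hcon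
    linarith [abs_add_le (∑ p ∈ Finset.univ.offDiag, A p.1 p.2 * (w p.1 * w p.2))
      (∑ i, A i i * (w i ^ 2 - 1))]
  have hexp : 1 / (8 * v * σ) * (x * σ / 2) = x / (16 * v) := by field_simp; ring
  calc Measure.pi ν {w | x * σ ≤ |w ⬝ᵥ A *ᵥ w - A.trace|}
      ≤ _ := (measure_mono hsub).trans (measure_union_le _ _)
    _ ≤ _ := add_le_add (measure_le_abs_sum_offDiag_le hν hv hσ hA _)
        (measure_le_abs_sum_mul_sq_sub_one_le hν hv hν2 hσ hdiag _)
    _ = ENNReal.ofReal (hansonWrightConst v * Real.exp (-(x / (16 * v)))) := by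
        rw [← ENNReal.ofReal_add (by positivity) (by positivity), hexp, hansonWrightConst, add_mul]

end QuadraticForm

/-- The properties of the law `ν` of a latent coordinate that the concentration bounds use: unit
second moment, and a sub-Gaussian moment generating function with variance proxy `v`. -/
structure IsSubgaussianUnitLaw (v : ℝ≥0) (ν : Measure ℝ) : Prop where
  isProbabilityMeasure : IsProbabilityMeasure ν
  hasSubgaussianMGF : HasSubgaussianMGF (fun w => w) v ν
  integral_sq : ∫ w, w ^ 2 ∂ν = 1

lemma hasSubgaussianMGF_mono {α : Type*} {mα : MeasurableSpace α} {P : Measure α} {X : α → ℝ}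
    {v v' : ℝ≥0} (h : HasSubgaussianMGF X v P) (hv : v ≤ v') : HasSubgaussianMGF X v' P :=
  ⟨h.integrable_exp_mul, fun t => (h.mgf_le t).trans (by gcongr)⟩

lemma IsSubgaussianUnitLaw.mono {v v' : ℝ≥0} {ν : Measure ℝ} (h : IsSubgaussianUnitLaw v ν)
    (hv : v ≤ v') : IsSubgaussianUnitLaw v' ν :=
  { h with hasSubgaussianMGF := hasSubgaussianMGF_mono h.hasSubgaussianMGF hv }

lemma IsEntryLaw.isSubgaussianUnitLaw {R : ℝ} {ν : Measure ℝ} (h : IsEntryLaw R ν) :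
    IsSubgaussianUnitLaw (max 1 (‖R‖₊ ^ 2)) ν := by
  rcases h with rfl | ⟨hprob, hR, hmean, hsq⟩
  · refine ⟨inferInstance, hasSubgaussianMGF_mono (v := 1) ⟨fun t =>
      integrable_exp_mul_gaussianReal t, fun t => by simp [mgf_fun_id_gaussianReal]⟩
      (le_max_left _ _), ?_⟩
    have hvar := variance_fun_id_gaussianReal (μ := 0) (v := 1)
    rwa [variance_of_integral_eq_zero (by fun_prop) (by simp)] at hvar
  · refine ⟨hprob, hasSubgaussianMGF_mono (v := ‖R‖₊ ^ 2) ?_ (le_max_right _ _), hsq⟩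
    have hHoeffding := hasSubgaussianMGF_of_mem_Icc_of_integral_eq_zero (X := fun w : ℝ => w)
      (by fun_prop) (hR.mono fun w hw => abs_le.1 hw) hmean
    rwa [sub_neg_eq_add, ← two_mul, nnnorm_mul, Real.nnnorm_ofNat,
      mul_div_cancel_left₀ _ two_ne_zero] at hHoeffding

section SquareRoot

variable {d : ℕ} {S : Matrix (Fin d) (Fin d) ℝ}

lemma transpose_sqrt (S : Matrix (Fin d) (Fin d) ℝ) : (CFC.sqrt S)ᵀ = CFC.sqrt S := by
  have hsymm : (CFC.sqrt S)ᴴ = CFC.sqrt S := (CFC.sqrt_nonneg S).isSelfAdjoint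
  rwa [conjTranspose_eq_transpose_of_trivial] at hsymm

lemma sum_sqrt_mulVec_sq_le (hS : S.PosSemidef) (a : Fin d → ℝ) :
    ∑ i, (CFC.sqrt S *ᵥ a) i ^ 2 ≤ ‖S‖ * ∑ i, a i ^ 2 := by
  have h := pow_le_pow_left₀ (norm_nonneg _)
    (Matrix.l2_opNorm_mulVec (CFC.sqrt S) (WithLp.toLp 2 a)) 2
  rwa [mul_pow, CFC.norm_sqrt S hS.nonneg, Real.sq_sqrt (norm_nonneg S),
    EuclideanSpace.real_norm_sq_eq, EuclideanSpace.real_norm_sq_eq] at h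

lemma sum_sqrt_mulVec_sq (hS : S.PosSemidef) (w : Fin d → ℝ) :
    ∑ i, (CFC.sqrt S *ᵥ w) i ^ 2 = w ⬝ᵥ S *ᵥ w := by
  calc ∑ i, (CFC.sqrt S *ᵥ w) i ^ 2 = CFC.sqrt S *ᵥ w ⬝ᵥ CFC.sqrt S *ᵥ w := by
        simp only [dotProduct, sq]
    _ = w ⬝ᵥ S *ᵥ w := by
        rw [dotProduct_mulVec, vecMul_mulVec, transpose_sqrt,
          CFC.sqrt_mul_sqrt_self S hS.nonneg, ← dotProduct_mulVec]

lemma sum_sqrt_apply_sq (hS : S.PosSemidef) (i : Fin d) : ∑ j, CFC.sqrt S i j ^ 2 = S i i := by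
  conv_rhs => rw [← CFC.sqrt_mul_sqrt_self S hS.nonneg]
  nth_rewrite 3 [← transpose_sqrt]
  simp only [mul_apply, transpose_apply, sq]

lemma sum_sum_sqrt_sq (hS : S.PosSemidef) : ∑ i, ∑ j, CFC.sqrt S i j ^ 2 = S.trace := by
  simp only [sum_sqrt_apply_sq hS, trace, diag_apply]

lemma sum_sum_sq_le (hS : S.PosSemidef) : ∑ i, ∑ j, S i j ^ 2 ≤ ‖S‖ * S.trace := by
  have hcol (j : Fin d) : ∑ i, S i j ^ 2 ≤ ‖S‖ * S j j := by
    calc ∑ i, S i j ^ 2 = ∑ i, (CFC.sqrt S *ᵥ CFC.sqrt S j) i ^ 2 := by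
          conv_lhs => rw [← CFC.sqrt_mul_sqrt_self S hS.nonneg]
          nth_rewrite 2 [← transpose_sqrt]
          rfl
      _ ≤ ‖S‖ * S j j := by
          rw [← sum_sqrt_apply_sq hS]
          exact sum_sqrt_mulVec_sq_le hS _
  rw [Finset.sum_comm, trace, Finset.mul_sum]
  exact Finset.sum_le_sum fun j _ => hcol j

end SquareRoot

section CovLaw

variable {d : ℕ} {S : Matrix (Fin d) (Fin d) ℝ} {v : ℝ≥0} {ν : Measure ℝ}

lemma measurable_sqrt_mulVec (S : Matrix (Fin d) (Fin d) ℝ) :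
    Measurable fun w : Fin d → ℝ => (WithLp.toLp 2 (CFC.sqrt S *ᵥ w) : E d) :=
  (WithLp.measurable_toLp 2 _).comp
    (Continuous.matrix_mulVec continuous_const continuous_id).measurable

instance isProbabilityMeasure_covLaw (S : Matrix (Fin d) (Fin d) ℝ) [IsProbabilityMeasure ν] :
    IsProbabilityMeasure (covLaw S ν) :=
  Measure.isProbabilityMeasure_map (measurable_sqrt_mulVec S).aemeasurable

lemma covLaw_abs_norm_sq_sub_trace_le (hS : S.PosSemidef) (hS0 : 0 < ‖S‖ * S.trace)
    (hν : IsSubgaussianUnitLaw v ν) (hv : 0 < v) (x : ℝ) :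
    covLaw S ν {z | x * √(‖S‖ * S.trace) ≤ |‖z‖ ^ 2 - S.trace|} ≤
      ENNReal.ofReal (hansonWrightConst v * Real.exp (-(x / (16 * v)))) := by
  have := hν.isProbabilityMeasure
  rw [covLaw, Measure.map_apply (measurable_sqrt_mulVec S)
    (measurableSet_le (by fun_prop) (by fun_prop))]
  simp only [Set.preimage_ofPred_eq, EuclideanSpace.real_norm_sq_eq, sum_sqrt_mulVec_sq hS]
  exact measure_quadForm_sub_trace_le (fun _ => hν.hasSubgaussianMGF) hv
    (fun _ => hν.integral_sq) (Real.sqrt_pos.2 hS0)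
    ((sum_sum_sq_le hS).trans_eq (Real.sq_sqrt hS0.le).symm) x

lemma hasSubgaussianMGF_inner_covLaw (hS : S.PosSemidef) (hν : IsSubgaussianUnitLaw v ν)
    (a : E d) : HasSubgaussianMGF (fun z => inner ℝ a z) (v * (‖S‖₊ * ‖a‖₊ ^ 2)) (covLaw S ν) := by
  have := hν.isProbabilityMeasure
  have hlinear (w : Fin d → ℝ) : inner ℝ a (WithLp.toLp 2 (CFC.sqrt S *ᵥ w) : E d) =
      ∑ i, (CFC.sqrt S *ᵥ a.ofLp) i * w i := by
    calc inner ℝ a (WithLp.toLp 2 (CFC.sqrt S *ᵥ w) : E d) = a.ofLp ⬝ᵥ CFC.sqrt S *ᵥ w := by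
          rw [EuclideanSpace.inner_eq_star_dotProduct, star_trivial, dotProduct_comm]
      _ = ∑ i, (CFC.sqrt S *ᵥ a.ofLp) i * w i := by
          rw [dotProduct_mulVec, ← mulVec_transpose, transpose_sqrt]
          rfl
  have hproxy : ∑ i, ‖(CFC.sqrt S *ᵥ a.ofLp) i‖₊ ^ 2 ≤ ‖S‖₊ * ‖a‖₊ ^ 2 := by
    rw [← NNReal.coe_le_coe]
    push_cast
    simpa only [Real.norm_eq_abs, sq_abs, EuclideanSpace.real_norm_sq_eq] using
      sum_sqrt_mulVec_sq_le hS a.ofLp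
  refine (hasSubgaussianMGF_mono (hasSubgaussianMGF_sum_mul (fun _ => hν.hasSubgaussianMGF)
    (CFC.sqrt S *ᵥ a.ofLp)) (mul_le_mul_right hproxy v)).congr_identDistrib
      ⟨(Finset.measurable_sum _ fun i _ => (measurable_pi_apply i).const_mul _).aemeasurable,
        by fun_prop, ?_⟩
  rw [covLaw, Measure.map_map (by fun_prop) (measurable_sqrt_mulVec S)]
  simp only [Function.comp_def, hlinear]

lemma expMoment_covLaw_norm_sq_le (hS : S.PosSemidef) (hν : IsSubgaussianUnitLaw v ν)
    {s : ℝ} (hs : 4 * s * (v * S.trace) ≤ 1) :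
    expMoment (covLaw S ν) (fun z => s * ‖z‖ ^ 2) ≤ 2 := by
  have := hν.isProbabilityMeasure
  rw [covLaw, expMoment_map (measurable_sqrt_mulVec S) (by fun_prop)]
  simp only [EuclideanSpace.real_norm_sq_eq]
  refine expMoment_sum_sq_le (fun i => hasSubgaussianMGF_sum_mul
    (fun _ => hν.hasSubgaussianMGF) (CFC.sqrt S i)) (fun i => by fun_prop) ?_
  push_cast
  simpa only [Real.norm_eq_abs, sq_abs, ← Finset.mul_sum, sum_sum_sqrt_sq hS] using hs

end CovLaw

/-- The values of `‖x‖² / τ` regarded as typical: within `η` of `1` in the covariance model, and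
equal to `1` in the spherical model. -/
def NormGood (model : InputModel) (η t : ℝ) : Prop :=
  match model with
  | .cov => |t - 1| ≤ η
  | .sphere => t = 1

lemma NormGood.abs_sub_one_le {model : InputModel} {η t : ℝ} (h : NormGood model η t)
    (hη : 0 ≤ η) : |t - 1| ≤ η := by
  cases model with
  | cov => exact h
  | sphere => simpa only [show t = 1 from h, sub_self, abs_zero] using hη

lemma NormGood.mono {model : InputModel} {η η' t : ℝ} (h : NormGood model η t) (hη : η ≤ η') :
    NormGood model η' t := by
  cases model with
  | cov => exact le_trans (show |t - 1| ≤ η from h) hη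
  | sphere => exact h

lemma measurableSet_normGood (model : InputModel) (η : ℝ) :
    MeasurableSet {t | NormGood model η t} := by
  cases model with
  | cov => exact measurableSet_le (by fun_prop : Measurable fun t : ℝ => |t - 1|) measurable_const
  | sphere => exact measurableSet_singleton (1 : ℝ)

section InputLaw

variable {d : ℕ} {S : Matrix (Fin d) (Fin d) ℝ} {v : ℝ≥0} {ν : Measure ℝ}

lemma effDim_eq_trace (hS1 : ‖S‖ = 1) : effDim S = S.trace := by rw [effDim, hS1, div_one]

lemma norm_sphereProj_sq_div {τ : ℝ} (hτ : 0 < τ) {z : E d} (hz : z ≠ 0) :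
    ‖(√τ * ‖z‖⁻¹) • z‖ ^ 2 / τ = 1 := by
  have hz0 : 0 < ‖z‖ := norm_pos_iff.2 hz
  rw [norm_smul, Real.norm_of_nonneg (by positivity), mul_assoc, inv_mul_cancel₀ hz0.ne', mul_one,
    Real.sq_sqrt hτ.le, div_self hτ.ne']

lemma norm_sphereProj_sq_div_le {τ : ℝ} (hτ : 0 < τ) (z : E d) :
    ‖(√τ * ‖z‖⁻¹) • z‖ ^ 2 / τ ≤ 1 := by
  rcases eq_or_ne z 0 with rfl | hz
  · simp
  · exact (norm_sphereProj_sq_div hτ hz).le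

lemma covLaw_abs_norm_sq_sub_effDim_le (hS : S.PosSemidef) (hS1 : ‖S‖ = 1) (hτ : 0 < effDim S)
    (hν : IsSubgaussianUnitLaw v ν) (hv : 0 < v) (x : ℝ) :
    covLaw S ν {z | x * √(effDim S) ≤ |‖z‖ ^ 2 - effDim S|} ≤
      ENNReal.ofReal (hansonWrightConst v * Real.exp (-(x / (16 * v)))) := by
  have htrace : ‖S‖ * S.trace = effDim S := by rw [hS1, one_mul, effDim_eq_trace hS1]
  have h := covLaw_abs_norm_sq_sub_trace_le hS (hτ.trans_eq htrace.symm) hν hv x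
  rwa [htrace, ← effDim_eq_trace hS1] at h

lemma covLaw_abs_inner_le (hS : S.PosSemidef) (hS1 : ‖S‖ = 1) (hτ : 0 < effDim S)
    (hν : IsSubgaussianUnitLaw v ν) {a : E d} (ha : ‖a‖ ^ 2 ≤ 2 * effDim S) (s : ℝ) :
    covLaw S ν {z | s * effDim S ≤ |inner ℝ a z|} ≤
      ENNReal.ofReal (2 * Real.exp (v / 2) * Real.exp (-(s * √(effDim S) / 2))) := by
  set τ := effDim S
  have hsq : √τ ^ 2 = τ := Real.sq_sqrt hτ.le
  have hθ : 0 < 1 / (2 * √τ) := by positivity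
  have hproxy : ((v * (‖S‖₊ * ‖a‖₊ ^ 2) : ℝ≥0) : ℝ) * (1 / (2 * √τ)) ^ 2 / 2 ≤ v / 2 := by
    push_cast
    rw [hS1, one_mul, div_pow, one_pow, mul_pow, hsq, mul_one_div, mul_div_assoc]
    gcongr
    refine mul_le_of_le_one_right v.2 ?_
    rw [div_le_one (by positivity)]
    linarith
  have hexponent : 1 / (2 * √τ) * (s * τ) = s * √τ / 2 := by
    field_simp
    rw [hsq, mul_comm]
  refine (measure_le_abs_le_of_hasSubgaussianMGF (hasSubgaussianMGF_inner_covLaw hS hν a)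
    (by fun_prop) hθ (s * τ)).trans ?_
  rw [hexponent, ENNReal.ofReal_mul (by positivity), ENNReal.ofReal_mul (by positivity),
    ENNReal.ofReal_ofNat]
  gcongr

/-- The constant in the tail bounds for the input laws. -/
def tailConst (v : ℝ) : ℝ := 2 * Real.exp (v / 2) + hansonWrightConst v

lemma tailConst_nonneg (v : ℝ) : 0 ≤ tailConst v :=
  add_nonneg (by positivity) (hansonWrightConst_nonneg v)

lemma covLaw_not_normGood_le (hS : S.PosSemidef) (hS1 : ‖S‖ = 1) (hτ : 0 < effDim S)
    (hν : IsSubgaussianUnitLaw v ν) (hv : 0 < v) (η : ℝ) :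
    covLaw S ν {z | ¬ NormGood .cov η (‖z‖ ^ 2 / effDim S)} ≤
      ENNReal.ofReal (hansonWrightConst v * Real.exp (-(η * √(effDim S) / (16 * v)))) := by
  refine (measure_mono fun z hz => ?_).trans
    (covLaw_abs_norm_sq_sub_effDim_le hS hS1 hτ hν hv (η * √(effDim S)))
  have hdev : η < |‖z‖ ^ 2 / effDim S - 1| := not_le.1 hz
  rw [div_sub_one hτ.ne', abs_div, abs_of_pos hτ, lt_div_iff₀ hτ] at hdev
  rw [Set.mem_ofPred_eq, mul_assoc, Real.mul_self_sqrt hτ.le]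
  exact hdev.le

-- Only `z = 0` is not projected to the sphere.
lemma sphereLaw_not_normGood_le (hS : S.PosSemidef) (hS1 : ‖S‖ = 1) (hτ : 0 < effDim S)
    (hν : IsSubgaussianUnitLaw v ν) (hv : 0 < v) (η : ℝ) :
    sphereLaw S ν {z | ¬ NormGood .sphere η (‖z‖ ^ 2 / effDim S)} ≤
      ENNReal.ofReal (hansonWrightConst v * Real.exp (-(√(effDim S) / (16 * v)))) := by
  have hmeas : MeasurableSet {z : E d | ¬ NormGood .sphere η (‖z‖ ^ 2 / effDim S)} :=
    (measurableSet_normGood .sphere η).compl.preimage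
      (by fun_prop : Measurable fun z : E d => ‖z‖ ^ 2 / effDim S)
  rw [sphereLaw, Measure.map_apply (by fun_prop) hmeas]
  refine (measure_mono fun z hz => ?_).trans
    (covLaw_abs_norm_sq_sub_effDim_le hS hS1 hτ hν hv √(effDim S))
  have hz0 : z = 0 := not_imp_comm.1 (norm_sphereProj_sq_div hτ) hz
  simp [hz0, Real.mul_self_sqrt hτ.le, abs_of_pos hτ]

lemma inputLaw_not_normGood_le (model : InputModel) (hS : S.PosSemidef) (hS1 : ‖S‖ = 1)
    (hτ : 0 < effDim S) (hν : IsSubgaussianUnitLaw v ν) (hv : 0 < v) {η : ℝ} (hη0 : 0 ≤ η)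
    (hη1 : η ≤ 1) :
    inputLaw model S ν {z | ¬ NormGood model η (‖z‖ ^ 2 / effDim S)} ≤
      ENNReal.ofReal (tailConst v * Real.exp (-(η * √(effDim S) / (32 * v)))) := by
  have : (0 : ℝ) < v := hv
  have hconst : hansonWrightConst v ≤ tailConst v := le_add_of_nonneg_left (by positivity)
  have := tailConst_nonneg v
  cases model with
  | cov =>
    refine (covLaw_not_normGood_le hS hS1 hτ hν hv η).trans (ENNReal.ofReal_le_ofReal ?_)
    gcongr
    norm_num
  | sphere =>
    refine (sphereLaw_not_normGood_le hS hS1 hτ hν hv η).trans (ENNReal.ofReal_le_ofReal ?_)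
    gcongr
    · exact mul_le_of_le_one_left (by positivity) hη1
    · norm_num

-- Either `‖z‖` is at least `√τ / 2`, so that projecting at most doubles the inner product, or
-- `‖z‖²` deviates from `τ`.
lemma sphereLaw_abs_inner_le (hS : S.PosSemidef) (hS1 : ‖S‖ = 1) (hτ : 0 < effDim S)
    (hν : IsSubgaussianUnitLaw v ν) (hv : 0 < v) {a : E d} (ha : ‖a‖ ^ 2 ≤ 2 * effDim S)
    (s : ℝ) :
    sphereLaw S ν {z | s * effDim S ≤ |inner ℝ a z|} ≤
      ENNReal.ofReal (2 * Real.exp (v / 2) * Real.exp (-(s * √(effDim S) / 4))) +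
        ENNReal.ofReal (hansonWrightConst v * Real.exp (-(√(effDim S) / (32 * v)))) := by
  set τ := effDim S
  have hsqrt : 0 < √τ := Real.sqrt_pos.2 hτ
  have hsq : √τ * √τ = τ := Real.mul_self_sqrt hτ.le
  have hsub : (fun z : E d => (√τ * ‖z‖⁻¹) • z) ⁻¹' {z | s * τ ≤ |inner ℝ a z|} ⊆
      {z | s / 2 * τ ≤ |inner ℝ a z|} ∪ {z | √τ / 2 * √τ ≤ |‖z‖ ^ 2 - τ|} := by
    intro z (hz : s * τ ≤ |inner ℝ a ((√τ * ‖z‖⁻¹) • z)|)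
    rw [inner_smul_right, abs_mul, abs_of_nonneg (by positivity)] at hz
    rcases le_or_gt (√τ / 2) ‖z‖ with hlarge | hsmall
    · left
      have hz0 : 0 < ‖z‖ := (half_pos hsqrt).trans_le hlarge
      have hscale : √τ * ‖z‖⁻¹ ≤ 2 := by
        rw [← div_eq_mul_inv, div_le_iff₀ hz0]
        linarith
      have hdouble := mul_le_mul_of_nonneg_right hscale (abs_nonneg (inner ℝ a z))
      rw [Set.mem_ofPred_eq]
      linarith
    · right
      have hnorm : ‖z‖ ^ 2 ≤ τ / 4 := by nlinarith [norm_nonneg z]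
      rw [Set.mem_ofPred_eq, abs_of_nonpos (by linarith)]
      linarith
  have hinner := covLaw_abs_inner_le hS hS1 hτ hν ha (s / 2)
  have hnorm := covLaw_abs_norm_sq_sub_effDim_le hS hS1 hτ hν hv (√τ / 2)
  rw [show s / 2 * √τ / 2 = s * √τ / 4 by ring] at hinner
  rw [show √τ / 2 / (16 * v) = √τ / (32 * v) by ring] at hnorm
  rw [sphereLaw, Measure.map_apply (by fun_prop) (measurableSet_le (by fun_prop) (by fun_prop))]
  exact (measure_mono hsub).trans ((measure_union_le _ _).trans (add_le_add hinner hnorm))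

lemma inputLaw_abs_inner_le (model : InputModel) (hS : S.PosSemidef) (hS1 : ‖S‖ = 1)
    (hτ : 0 < effDim S) (hν : IsSubgaussianUnitLaw v ν) (hv : 1 ≤ v) {a : E d}
    (ha : ‖a‖ ^ 2 ≤ 2 * effDim S) {η : ℝ} (hη0 : 0 ≤ η) (hη1 : η ≤ 1) :
    inputLaw model S ν {z | η * effDim S ≤ |inner ℝ a z|} ≤
      ENNReal.ofReal (tailConst v * Real.exp (-(η * √(effDim S) / (32 * v)))) := by
  have : (1 : ℝ) ≤ v := hv
  have := hansonWrightConst_nonneg v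
  cases model with
  | cov =>
    refine (covLaw_abs_inner_le hS hS1 hτ hν ha η).trans (ENNReal.ofReal_le_ofReal ?_)
    have hconst : 2 * Real.exp (v / 2) ≤ tailConst v := le_add_of_nonneg_right this
    have := tailConst_nonneg v
    gcongr
    linarith
  | sphere =>
    refine (sphereLaw_abs_inner_le hS hS1 hτ hν (by positivity) ha η).trans ?_
    rw [← ENNReal.ofReal_add (by positivity) (by positivity), tailConst, add_mul]
    refine ENNReal.ofReal_le_ofReal (add_le_add ?_ ?_)
    · gcongr
      linarith
    · gcongr
      exact mul_le_of_le_one_left (by positivity) hη1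

/-- A bound for the `k`-th moment of `1 + ‖x‖² / τ` under the input laws. -/
def momentConst (v : ℝ) (k : ℕ) : ℝ :=
  2 * (k.factorial * (4 * v) ^ k * Real.exp (1 / (4 * v))) + 2 ^ k

lemma lintegral_covLaw_one_add_pow_le (hS : S.PosSemidef) (hS1 : ‖S‖ = 1) (hτ : 0 < effDim S)
    (hν : IsSubgaussianUnitLaw v ν) (hv : 0 < v) (k : ℕ) :
    ∫⁻ z, ENNReal.ofReal ((1 + ‖z‖ ^ 2 / effDim S) ^ k) ∂(covLaw S ν) ≤
      ENNReal.ofReal (2 * (k.factorial * (4 * v) ^ k * Real.exp (1 / (4 * v)))) := by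
  have : (0 : ℝ) < v := hv
  set D : ℝ := k.factorial * (4 * v) ^ k * Real.exp (1 / (4 * v))
  set s : ℝ := 1 / (4 * v * effDim S)
  have hpow (z : E d) : (1 + ‖z‖ ^ 2 / effDim S) ^ k ≤ D * Real.exp (s * ‖z‖ ^ 2) := by
    have h := Real.pow_div_factorial_le_exp ((1 + ‖z‖ ^ 2 / effDim S) / (4 * v))
      (by positivity) k
    rw [div_le_iff₀ (by positivity), div_pow, div_le_iff₀ (by positivity), add_div,
      Real.exp_add] at h
    refine h.trans_eq ?_
    rw [show ‖z‖ ^ 2 / effDim S / (4 * v) = s * ‖z‖ ^ 2 by simp only [s]; field_simp]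
    ring
  have hs : 4 * s * (v * S.trace) ≤ 1 := by
    rw [← effDim_eq_trace hS1]
    simp only [s]
    field_simp
    rfl
  calc ∫⁻ z, ENNReal.ofReal ((1 + ‖z‖ ^ 2 / effDim S) ^ k) ∂(covLaw S ν)
      ≤ ∫⁻ z, ENNReal.ofReal D * ENNReal.ofReal (Real.exp (s * ‖z‖ ^ 2)) ∂(covLaw S ν) := by
        refine lintegral_mono fun z => ?_
        rw [← ENNReal.ofReal_mul (by positivity)]
        exact ENNReal.ofReal_le_ofReal (hpow z)
    _ = ENNReal.ofReal D * expMoment (covLaw S ν) (fun z => s * ‖z‖ ^ 2) :=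
        lintegral_const_mul _ (by fun_prop)
    _ ≤ ENNReal.ofReal D * 2 := by
        gcongr
        exact expMoment_covLaw_norm_sq_le hS hν hs
    _ = ENNReal.ofReal (2 * D) := by
        rw [ENNReal.ofReal_mul zero_le_two, ENNReal.ofReal_ofNat, mul_comm]

lemma lintegral_sphereLaw_one_add_pow_le [IsProbabilityMeasure ν] (hτ : 0 < effDim S) (k : ℕ) :
    ∫⁻ z, ENNReal.ofReal ((1 + ‖z‖ ^ 2 / effDim S) ^ k) ∂(sphereLaw S ν) ≤
      ENNReal.ofReal (2 ^ k) := by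
  rw [sphereLaw, lintegral_map (by fun_prop) (by fun_prop)]
  calc ∫⁻ z, ENNReal.ofReal ((1 + ‖(√(effDim S) * ‖z‖⁻¹) • z‖ ^ 2 / effDim S) ^ k) ∂(covLaw S ν)
      ≤ ∫⁻ _, ENNReal.ofReal (2 ^ k) ∂(covLaw S ν) := by
        refine lintegral_mono fun z => ENNReal.ofReal_le_ofReal ?_
        gcongr
        linarith [norm_sphereProj_sq_div_le hτ z]
    _ = ENNReal.ofReal (2 ^ k) := by rw [lintegral_const, measure_univ, mul_one]

lemma lintegral_inputLaw_one_add_pow_le (model : InputModel) (hS : S.PosSemidef) (hS1 : ‖S‖ = 1)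
    (hτ : 0 < effDim S) (hν : IsSubgaussianUnitLaw v ν) (hv : 0 < v) (k : ℕ) :
    ∫⁻ z, ENNReal.ofReal ((1 + ‖z‖ ^ 2 / effDim S) ^ k) ∂(inputLaw model S ν) ≤
      ENNReal.ofReal (momentConst v k) := by
  have := hν.isProbabilityMeasure
  cases model with
  | cov =>
    exact (lintegral_covLaw_one_add_pow_le hS hS1 hτ hν hv k).trans
      (ENNReal.ofReal_le_ofReal (le_add_of_nonneg_right (by positivity)))
  | sphere =>
    exact (lintegral_sphereLaw_one_add_pow_le hτ k).trans
      (ENNReal.ofReal_le_ofReal (le_add_of_nonneg_left (by positivity)))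

end InputLaw

section Taylor

lemma eventually_forall_abs_le_of_continuousAt {α : Type*} [PseudoMetricSpace α] {f : α → ℝ}
    {x₀ : α} (hf : ContinuousAt f x₀) :
    ∀ᶠ δ : ℝ in 𝓝[>] 0, ∀ x ∈ Metric.closedBall x₀ δ, |f x| ≤ |f x₀| + 1 :=
  have hnear : ∀ᶠ x in 𝓝 x₀, |f x| ≤ |f x₀| + 1 :=
    (hf.abs.eventually (gt_mem_nhds (lt_add_one _))).mono fun _ => le_of_lt
  (eventually_closedBall_subset hnear).filter_mono nhdsWithin_le_nhds

lemma abs_sub_add_sum_le_of_hasDerivAt {m : ℕ} {f f' : ℝ → ℝ} {b : ℕ → ℝ} {C t₀ t : ℝ}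
    (hC : 0 ≤ C) (hf : ∀ y ∈ Set.uIcc t₀ t, HasDerivAt f (f' y) y)
    (hf' : ∀ y ∈ Set.uIcc t₀ t,
      |f' y - ∑ l ∈ Finset.range m, b l * (y - t₀) ^ l| ≤ C * |y - t₀| ^ m) :
    |f t - (f t₀ + ∑ l ∈ Finset.range m, b l / (l + 1) * (t - t₀) ^ (l + 1))| ≤
      C * |t - t₀| ^ (m + 1) := by
  set D : ℝ → ℝ := fun y => f y - ∑ l ∈ Finset.range m, b l / (l + 1) * (y - t₀) ^ (l + 1)
  have hmono (l : ℕ) (y : ℝ) :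
      HasDerivAt (fun y => b l / (l + 1) * (y - t₀) ^ (l + 1)) (b l * (y - t₀) ^ l) y := by
    refine ((((hasDerivAt_id y).sub_const t₀).fun_pow (l + 1)).const_mul _).congr_deriv ?_
    have : (l : ℝ) + 1 ≠ 0 := by positivity
    simp only [id, Nat.cast_add, Nat.cast_one, Nat.add_sub_cancel, mul_one]
    field_simp
  have hderiv (y : ℝ) (hy : y ∈ Set.uIcc t₀ t) :
      HasDerivWithinAt D (f' y - ∑ l ∈ Finset.range m, b l * (y - t₀) ^ l) (Set.uIcc t₀ t) y :=
    ((hf y hy).sub (HasDerivAt.fun_sum fun l _ => hmono l y)).hasDerivWithinAt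
  have hbound (y : ℝ) (hy : y ∈ Set.uIcc t₀ t) :
      ‖f' y - ∑ l ∈ Finset.range m, b l * (y - t₀) ^ l‖ ≤ C * |t - t₀| ^ m := by
    refine (hf' y hy).trans ?_
    have := Set.abs_sub_left_of_mem_uIcc hy
    gcongr
  have hmean := (convex_uIcc t₀ t).norm_image_sub_le_of_norm_hasDerivWithin_le hderiv hbound
    Set.left_mem_uIcc Set.right_mem_uIcc
  have hD₀ : D t₀ = f t₀ := by
    simp only [D, sub_self, ne_eq, Nat.add_eq_zero_iff, one_ne_zero, and_false,
      not_false_eq_true, zero_pow, mul_zero, Finset.sum_const_zero, sub_zero]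
  rw [hD₀, Real.norm_eq_abs, Real.norm_eq_abs] at hmean
  calc |f t - (f t₀ + ∑ l ∈ Finset.range m, b l / (l + 1) * (t - t₀) ^ (l + 1))|
      = |D t - f t₀| := by congr 1; simp only [D]; ring
    _ ≤ C * |t - t₀| ^ (m + 1) := by rwa [pow_succ, ← mul_assoc]

/-- `F` has, near `p₀`, a Taylor expansion of order `m` in its second variable, with coefficients
that are functions of the first variable and with all constants uniform in it. -/
def HasUniformTaylorSnd {V : Type*} [PseudoMetricSpace V] (m : ℕ) (F : V × ℝ → ℝ) (p₀ : V × ℝ) :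
    Prop :=
  ∃ (a : ℕ → V → ℝ) (C : ℝ), 0 ≤ C ∧ ∀ᶠ δ : ℝ in 𝓝[>] 0, ∀ s ∈ Metric.closedBall p₀.1 δ,
    (∀ l < m, |a l s| ≤ C) ∧ ∀ t ∈ Metric.closedBall p₀.2 δ,
      |F (s, t) - ∑ l ∈ Finset.range m, a l s * (t - p₀.2) ^ l| ≤ C * |t - p₀.2| ^ m

lemma hasUniformTaylorSnd_zero {V : Type*} [PseudoMetricSpace V] {F : V × ℝ → ℝ}
    {p₀ : V × ℝ} (hF : ContinuousAt F p₀) : HasUniformTaylorSnd 0 F p₀ := by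
  refine ⟨fun _ _ => 0, |F p₀| + 1, by positivity, ?_⟩
  filter_upwards [eventually_forall_abs_le_of_continuousAt hF] with δ hδ s hs
  refine ⟨by simp, fun t ht => ?_⟩
  simpa using hδ (s, t) (closedBall_prod_same p₀.1 p₀.2 δ ▸ Set.mk_mem_prod hs ht)

variable {V : Type*} [NormedAddCommGroup V] [NormedSpace ℝ V]

lemma HasUniformTaylorSnd.of_fderiv {m : ℕ} {F : V × ℝ → ℝ} {p₀ : V × ℝ} (hF : ContinuousAt F p₀)
    (hdiff : ∀ᶠ p in 𝓝 p₀, DifferentiableAt ℝ F p)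
    (h : HasUniformTaylorSnd m (fun p => fderiv ℝ F p (0, 1)) p₀) :
    HasUniformTaylorSnd (m + 1) F p₀ := by
  obtain ⟨a, C, hC, hev⟩ := h
  refine ⟨fun | 0, s => F (s, p₀.2) | l + 1, s => a l s / (l + 1), C + (|F p₀| + 1),
    by positivity, ?_⟩
  have hC' : C ≤ C + (|F p₀| + 1) := le_add_of_nonneg_right (by positivity)
  filter_upwards [hev, eventually_forall_abs_le_of_continuousAt hF,
    (eventually_closedBall_subset hdiff).filter_mono nhdsWithin_le_nhds, self_mem_nhdsWithin]
    with δ htaylor hbound hdiff (hδ : 0 < δ) s hs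
  have hbox {t : ℝ} (ht : t ∈ Metric.closedBall p₀.2 δ) : (s, t) ∈ Metric.closedBall p₀ δ :=
    closedBall_prod_same p₀.1 p₀.2 δ ▸ Set.mk_mem_prod hs ht
  obtain ⟨ha, hrem⟩ := htaylor s hs
  refine ⟨fun l hl => ?_, fun t ht => ?_⟩
  · cases l with
    | zero =>
      exact (hbound _ (hbox (Metric.mem_closedBall_self hδ.le))).trans (le_add_of_nonneg_left hC)
    | succ l =>
      rw [abs_div, abs_of_pos (by positivity : (0 : ℝ) < l + 1)]
      exact (div_le_self (abs_nonneg _) (by simp)).trans ((ha l (by omega)).trans hC')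
  · have hseg (y : ℝ) (hy : y ∈ Set.uIcc p₀.2 t) : y ∈ Metric.closedBall p₀.2 δ :=
      (Set.abs_sub_left_of_mem_uIcc hy).trans ht
    have hderiv (y : ℝ) (hy : y ∈ Set.uIcc p₀.2 t) :
        HasDerivAt (fun y => F (s, y)) (fderiv ℝ F (s, y) (0, 1)) y :=
      (hdiff (hbox (hseg y hy))).hasFDerivAt.comp_hasDerivAt y
        ((hasDerivAt_const y s).prodMk (hasDerivAt_id y))
    rw [Finset.sum_range_succ', pow_zero, mul_one, add_comm (Finset.sum _ _)]
    push_cast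
    exact (abs_sub_add_sum_le_of_hasDerivAt hC hderiv fun y hy => hrem y (hseg y hy)).trans
      (mul_le_mul_of_nonneg_right hC' (by positivity))

lemma hasUniformTaylorSnd_of_contDiffAt {m : ℕ} {F : V × ℝ → ℝ} {p₀ : V × ℝ}
    (hF : ContDiffAt ℝ (m : ℕ∞) F p₀) : HasUniformTaylorSnd m F p₀ := by
  induction m generalizing F with
  | zero => exact hasUniformTaylorSnd_zero hF.continuousAt
  | succ m ih =>
    have hF1 : ContDiffAt ℝ (1 : ℕ∞) F p₀ := hF.of_le (by norm_cast; omega)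
    exact .of_fderiv hF.continuousAt
      ((hF1.eventually (by simp)).mono fun p hp => hp.differentiableAt (by simp))
      (ih ((hF.fderiv_right (m := (m : ℕ∞)) (by norm_cast)).clm_apply contDiffAt_const))

lemma exists_uniform_taylor_of_contDiffOn {q : ℕ} {f : ℕ → V × ℝ → ℝ} {p₀ : V × ℝ}
    (hf : ∀ j ≤ q, ∃ U ∈ 𝓝 p₀, ContDiffOn ℝ ((q + 1 - j : ℕ) : ℕ∞) (f j) U) :
    ∃ (a : ℕ → ℕ → V → ℝ) (C : ℕ → ℝ), (∀ j, 0 ≤ C j) ∧ ∀ᶠ δ : ℝ in 𝓝[>] 0,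
      ∀ j ∈ Finset.range (q + 1), ∀ s ∈ Metric.closedBall p₀.1 δ,
        (∀ l < q + 1 - j, |a j l s| ≤ C j) ∧ ∀ t ∈ Metric.closedBall p₀.2 δ,
          |f j (s, t) - ∑ l ∈ Finset.range (q + 1 - j), a j l s * (t - p₀.2) ^ l| ≤
            C j * |t - p₀.2| ^ (q + 1 - j) := by
  have htaylor (j : ℕ) : ∃ (a : ℕ → V → ℝ) (C : ℝ), 0 ≤ C ∧ (j ∈ Finset.range (q + 1) →
      ∀ᶠ δ : ℝ in 𝓝[>] 0, ∀ s ∈ Metric.closedBall p₀.1 δ, (∀ l < q + 1 - j, |a l s| ≤ C) ∧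
        ∀ t ∈ Metric.closedBall p₀.2 δ,
          |f j (s, t) - ∑ l ∈ Finset.range (q + 1 - j), a l s * (t - p₀.2) ^ l| ≤
            C * |t - p₀.2| ^ (q + 1 - j)) := by
    by_cases hj : j ∈ Finset.range (q + 1)
    · obtain ⟨W, hW, hc⟩ := hf j (Finset.mem_range_succ_iff.1 hj)
      obtain ⟨a, C, hC, h⟩ := hasUniformTaylorSnd_of_contDiffAt (hc.contDiffAt hW)
      exact ⟨a, C, hC, fun _ => h⟩
    · exact ⟨fun _ _ => 0, 0, le_rfl, fun h => absurd h hj⟩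
  choose a C hC ha using htaylor
  exact ⟨a, C, hC, (Filter.eventually_all_finset _).2 ha⟩

end Taylor

/-- A polynomial approximation `g(s, t, u) ≈ ∑ coeff e s · u ^ e.1 · (t - 1) ^ e.2` to the function
defining the kernel, near `s = t = 1` and `u = 0`. The first argument belongs to a data point and
is kept exact; seen as polynomials in the test point, `u` has degree `1` and `t` has degree `2`, so
`m` bounds the total degree. -/
structure KernelApprox (model : InputModel) (q m : ℕ) (g : ℝ → ℝ → ℝ → ℝ) where
  index : Finset (Σ _ : ℕ, ℕ)
  coeff : (Σ _ : ℕ, ℕ) → ℝ → ℝ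
  bound : ℝ
  radius : ℝ
  bound_nonneg : 0 ≤ bound
  radius_pos : 0 < radius
  radius_le_one : radius ≤ 1
  degree_le : ∀ e ∈ index, e.1 + 2 * e.2 ≤ m
  abs_coeff_le : ∀ e ∈ index, ∀ s, |s - 1| ≤ radius → |coeff e s| ≤ bound
  abs_sub_le : ∀ η ≤ radius, ∀ s t u, NormGood model radius s → NormGood model η t →
    |u| ≤ η → |g s t u - ∑ e ∈ index, coeff e s * (u ^ e.1 * (t - 1) ^ e.2)| ≤
      bound * η ^ (q + 1)

lemma abs_sum_expansion_sub_le {q : ℕ} {a : ℕ → ℕ → ℝ} {C F : ℕ → ℝ} {t u η ρ Cr : ℝ}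
    (ht : |t| ≤ η) (hu : |u| ≤ η) (hC : ∀ j, 0 ≤ C j) (hρ : |ρ| ≤ Cr)
    (hF : ∀ j ∈ Finset.range (q + 1),
      |F j - ∑ l ∈ Finset.range (q + 1 - j), a j l * t ^ l| ≤ C j * |t| ^ (q + 1 - j)) :
    |∑ j ∈ Finset.range (q + 1), F j * u ^ j + u ^ (q + 1) * ρ -
        ∑ e ∈ (Finset.range (q + 1)).sigma fun j => Finset.range (q + 1 - j),
          a e.1 e.2 * (u ^ e.1 * t ^ e.2)| ≤
      (∑ j ∈ Finset.range (q + 1), C j + Cr) * η ^ (q + 1) := by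
  have hterm (j : ℕ) (hj : j ∈ Finset.range (q + 1)) :
      |(F j - ∑ l ∈ Finset.range (q + 1 - j), a j l * t ^ l) * u ^ j| ≤ C j * η ^ (q + 1) := by
    have := hC j
    have hη : 0 ≤ η := (abs_nonneg t).trans ht
    rw [abs_mul, abs_pow]
    calc _ ≤ C j * |t| ^ (q + 1 - j) * |u| ^ j := by gcongr; exact hF j hj
      _ ≤ C j * η ^ (q + 1 - j) * η ^ j := by gcongr
      _ = C j * η ^ (q + 1) := by
        rw [mul_assoc, ← pow_add, Nat.sub_add_cancel (Finset.mem_range.1 hj).le]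
  have hsplit : ∑ j ∈ Finset.range (q + 1), F j * u ^ j + u ^ (q + 1) * ρ -
        ∑ e ∈ (Finset.range (q + 1)).sigma fun j => Finset.range (q + 1 - j),
          a e.1 e.2 * (u ^ e.1 * t ^ e.2) =
      ∑ j ∈ Finset.range (q + 1), (F j - ∑ l ∈ Finset.range (q + 1 - j), a j l * t ^ l) * u ^ j +
        u ^ (q + 1) * ρ := by
    rw [Finset.sum_sigma, add_sub_right_comm, ← Finset.sum_sub_distrib]
    simp only [sub_mul, Finset.sum_mul, mul_assoc, mul_comm (t ^ _)]
  rw [hsplit, add_mul, Finset.sum_mul]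
  refine (abs_add_le _ _).trans (add_le_add
    ((Finset.abs_sum_le_sum_abs _ _).trans (Finset.sum_le_sum hterm)) ?_)
  rw [abs_mul, abs_pow, mul_comm]
  gcongr
  exact (abs_nonneg ρ).trans hρ

lemma HasExpansion.nonempty_kernelApprox {q : ℕ} {g : ℝ → ℝ → ℝ → ℝ} (hg : HasExpansion q g) :
    Nonempty (KernelApprox .cov q (2 * q) g) := by
  obtain ⟨δ, hδ, δ', hδ', gj, r, hexp, hgj, U, hU, hr⟩ := hg
  obtain ⟨a, C, hC, ha⟩ := exists_uniform_taylor_of_contDiffOn hgj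
  obtain ⟨ζ, ⟨hζtaylor, hζr⟩, ⟨hζ, hζδ⟩, hζδ'⟩ :=
    ((ha.and (eventually_forall_abs_le_of_continuousAt (hr.continuousAt hU))).and
      ((eventually_mem_set.2 (Ioo_mem_nhdsGT (lt_min hδ one_pos))).and
        (Ioo_mem_nhdsGT hδ'))).exists
  have hbound : 0 ≤ ∑ j ∈ Finset.range (q + 1), C j := Finset.sum_nonneg fun j _ => hC j
  exact ⟨{
    index := (Finset.range (q + 1)).sigma fun j => Finset.range (q + 1 - j)
    coeff := fun e s => a e.1 e.2 s
    bound := ∑ j ∈ Finset.range (q + 1), C j + (|r (1, 1, 0)| + 1)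
    radius := ζ
    bound_nonneg := by positivity
    radius_pos := hζ
    radius_le_one := (hζδ.trans_le (min_le_right _ _)).le
    degree_le := fun e he => by
      simp only [Finset.mem_sigma, Finset.mem_range] at he
      omega
    abs_coeff_le := fun e he s hs => by
      obtain ⟨hj, hl⟩ := Finset.mem_sigma.1 he
      exact ((hζtaylor e.1 hj s hs).1 e.2 (Finset.mem_range.1 hl)).trans
        (le_add_of_le_of_nonneg (Finset.single_le_sum (fun j _ => hC j) hj) (by positivity))
    abs_sub_le := fun η hη s t u (hs : |s - 1| ≤ ζ) (ht : |t - 1| ≤ η) hu => by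
      rw [hexp s (by constructor <;> linarith [abs_le.1 hs, min_le_left δ 1])
        t (by constructor <;> linarith [abs_le.1 ht, min_le_left δ 1])
        u (by constructor <;> linarith [abs_le.1 hu, hζδ'.2])]
      refine abs_sum_expansion_sub_le (a := fun j l => a j l s) ht hu hC
        (hζr (s, t, u) ?_) fun j hj => (hζtaylor j hj s hs).2 t (ht.trans hη)
      simpa [Prod.dist_eq, Real.dist_eq] using ⟨hs, ht.trans hη, hu.trans hη⟩ }⟩

lemma HasSphereExpansion.nonempty_kernelApprox {q : ℕ} {g : ℝ → ℝ → ℝ → ℝ}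
    (hg : HasSphereExpansion q g) : Nonempty (KernelApprox .sphere q q g) := by
  obtain ⟨δ', hδ', a, r, hexp, U, hU, hr⟩ := hg
  obtain ⟨ζ, hζr, hζ, hζδ⟩ := ((eventually_forall_abs_le_of_continuousAt
    (hr.continuousAt hU)).and (Ioo_mem_nhdsGT (lt_min hδ' one_pos))).exists
  have hsum : 0 ≤ ∑ j ∈ Finset.range (q + 1), |a j| := Finset.sum_nonneg fun j _ => abs_nonneg _
  exact ⟨{
    index := (Finset.range (q + 1)).sigma fun _ => Finset.range 1
    coeff := fun e _ => a e.1
    bound := ∑ j ∈ Finset.range (q + 1), |a j| + (|r 0| + 1)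
    radius := ζ
    bound_nonneg := by positivity
    radius_pos := hζ
    radius_le_one := (hζδ.trans_le (min_le_right _ _)).le
    degree_le := fun e he => by
      simp only [Finset.mem_sigma, Finset.mem_range] at he
      omega
    abs_coeff_le := fun e he s _ => le_add_of_le_of_nonneg
      (Finset.single_le_sum (f := fun j => |a j|) (fun j _ => abs_nonneg _)
        (Finset.mem_sigma.1 he).1) (by positivity)
    abs_sub_le := fun η hη s t u (hs : s = 1) (ht : t = 1) hu => by
      rw [hs, ht, hexp u (by constructor <;> linarith [abs_le.1 hu, min_le_left δ' 1]),
        Finset.sum_sigma]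
      simp only [Finset.range_one, Finset.sum_singleton, pow_zero, mul_one, add_sub_cancel_left]
      rw [abs_mul, abs_pow, mul_comm]
      have hr0 := hζr u (by simpa [Real.dist_eq] using hu.trans hη)
      gcongr
      exact le_add_of_nonneg_of_le hsum hr0 }⟩

lemma ExpansionAssumption.nonempty_kernelApprox {model : InputModel} {β : ℝ}
    {g : ℝ → ℝ → ℝ → ℝ} (hg : ExpansionAssumption model β g) :
    Nonempty (KernelApprox model ⌊2 / β⌋₊ (barrierDegree model β) g) := by
  cases model with
  | cov => exact HasExpansion.nonempty_kernelApprox hg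
  | sphere => exact HasSphereExpansion.nonempty_kernelApprox hg

section Spectrum

variable {n : Type*} [Fintype n] [DecidableEq n] {M : Matrix n n ℝ} {c : ℝ}

lemma mul_dotProduct_self_le_of_spectrum (hM : M.IsHermitian) (hc : ∀ e ∈ spectrum ℝ M, c ≤ e)
    (w : n → ℝ) : c * (w ⬝ᵥ w) ≤ w ⬝ᵥ M *ᵥ w := by
  have hle : algebraMap ℝ (Matrix n n ℝ) c ≤ M :=
    (algebraMap_le_iff_le_spectrum (a := M) (ha := hM)).2 hc
  have hquad := (Matrix.le_iff.1 hle).dotProduct_mulVec_nonneg w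
  rw [Matrix.sub_mulVec, dotProduct_sub, Algebra.algebraMap_eq_smul_one, Matrix.smul_mulVec,
    Matrix.one_mulVec, dotProduct_smul, star_trivial, smul_eq_mul] at hquad
  exact sub_nonneg.1 hquad

lemma isUnit_det_of_spectrum (hc₀ : 0 < c) (hc : ∀ e ∈ spectrum ℝ M, c ≤ e) : IsUnit M.det := by
  rw [← Matrix.isUnit_iff_isUnit_det]
  by_contra h
  exact hc₀.not_ge (hc 0 (spectrum.zero_mem ℝ h))

lemma sq_mul_dotProduct_self_le_of_spectrum (hM : M.IsHermitian) (hc₀ : 0 < c)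
    (hc : ∀ e ∈ spectrum ℝ M, c ≤ e) (w : n → ℝ) :
    c ^ 2 * (w ⬝ᵥ w) ≤ (M *ᵥ w) ⬝ᵥ (M *ᵥ w) := by
  have hsq : 0 ≤ (c • w - M *ᵥ w) ⬝ᵥ (c • w - M *ᵥ w) := by
    simpa using dotProduct_star_self_nonneg (c • w - M *ᵥ w)
  have hexpand : (c • w - M *ᵥ w) ⬝ᵥ (c • w - M *ᵥ w) =
      c ^ 2 * (w ⬝ᵥ w) - 2 * c * (w ⬝ᵥ M *ᵥ w) + (M *ᵥ w) ⬝ᵥ (M *ᵥ w) := by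
    simp only [sub_dotProduct, dotProduct_sub, smul_dotProduct, dotProduct_smul, smul_eq_mul,
      dotProduct_comm (M *ᵥ w) w]
    ring
  nlinarith [mul_dotProduct_self_le_of_spectrum hM hc w]

lemma sum_abs_inv_mulVec_le (hM : M.IsHermitian) (hc₀ : 0 < c) (hc : ∀ e ∈ spectrum ℝ M, c ≤ e)
    {B : ℝ} (hB : 0 ≤ B) {F : n → ℝ} (hF : ∀ i, |F i| ≤ B) :
    ∑ i, |(M⁻¹ *ᵥ F) i| ≤ Fintype.card n * B / c := by
  set w := M⁻¹ *ᵥ F with hw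
  have hMw : M *ᵥ w = F := by
    rw [hw, Matrix.mulVec_mulVec, Matrix.mul_nonsing_inv _ (isUnit_det_of_spectrum hc₀ hc),
      Matrix.one_mulVec]
  have hF_sq : F ⬝ᵥ F ≤ Fintype.card n * B ^ 2 := by
    rw [← nsmul_eq_mul]
    exact Finset.sum_le_card_nsmul _ _ _ fun i _ => by
      rw [← sq, ← sq_abs]
      exact pow_le_pow_left₀ (abs_nonneg _) (hF i) 2
  have hw_sq : c ^ 2 * ∑ i, |w i| ^ 2 ≤ Fintype.card n * B ^ 2 := by
    have := sq_mul_dotProduct_self_le_of_spectrum hM hc₀ hc w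
    rw [hMw] at this
    simpa only [sq_abs, dotProduct, ← sq] using this.trans hF_sq
  rw [le_div_iff₀ hc₀]
  refine (abs_le_of_sq_le_sq' ?_ (by positivity)).2
  calc ((∑ i, |w i|) * c) ^ 2
      ≤ (Fintype.card n * ∑ i, |w i| ^ 2) * c ^ 2 := by
        rw [mul_pow]
        gcongr
        exact sq_sum_le_card_mul_sum_sq
    _ = Fintype.card n * (c ^ 2 * ∑ i, |w i| ^ 2) := by ring
    _ ≤ Fintype.card n * (Fintype.card n * B ^ 2) := by gcongr
    _ = (Fintype.card n * B) ^ 2 := by ring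

end Spectrum

section Representer

variable {d n : ℕ} {𝒳 : Set (E d)} (H : Type*) [NormedAddCommGroup H] [InnerProductSpace ℝ H]
  [CompleteSpace H] [RKHS ℝ H 𝒳 ℝ]

/-- The element `∑ i, w i • k(x i, ·)` of a reproducing kernel Hilbert space. -/
def kernelSum (x : Fin n → 𝒳) (w : Fin n → ℝ) : H := ∑ i, w i • RKHS.kerFun H (x i) 1

variable {H} {x : Fin n → 𝒳} {w y : Fin n → ℝ} {lam : ℝ}

lemma inner_kernelSum (x : Fin n → 𝒳) (w : Fin n → ℝ) (f : H) :
    inner ℝ (kernelSum H x w) f = ∑ i, w i * f (x i) := by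
  simp only [kernelSum, sum_inner, real_inner_smul_left, RKHS.kerFun_inner,
    RCLike.inner_apply, map_one, mul_one]

lemma norm_sq_eq_norm_kernelSum_sq_add (x : Fin n → 𝒳) (w : Fin n → ℝ) (f : H) :
    ‖f‖ ^ 2 = ‖kernelSum H x w‖ ^ 2 + 2 * ∑ i, w i * (f (x i) - kernelSum H x w (x i)) +
      ‖f - kernelSum H x w‖ ^ 2 := by
  have h := norm_add_sq_real (kernelSum H x w) (f - kernelSum H x w)
  simpa only [add_sub_cancel, inner_kernelSum, RKHS.coe_sub, Pi.sub_apply] using h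

lemma ridge_objective_eq (hw : ∀ i, kernelSum H x w (x i) + lam * w i = y i) (f : H) :
    ∑ i, (y i - f (x i)) ^ 2 + lam * ‖f‖ ^ 2 =
      (∑ i, (y i - kernelSum H x w (x i)) ^ 2 + lam * ‖kernelSum H x w‖ ^ 2) +
        (∑ i, (f (x i) - kernelSum H x w (x i)) ^ 2 + lam * ‖f - kernelSum H x w‖ ^ 2) := by
  have hterm (i : Fin n) : (y i - f (x i)) ^ 2 = (y i - kernelSum H x w (x i)) ^ 2 +
      (f (x i) - kernelSum H x w (x i)) ^ 2 -
        2 * lam * (w i * (f (x i) - kernelSum H x w (x i))) := by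
    rw [← hw i]
    ring
  simp only [hterm, Finset.sum_sub_distrib, Finset.sum_add_distrib, ← Finset.mul_sum]
  rw [norm_sq_eq_norm_kernelSum_sq_add x w f]
  ring

lemma norm_sq_eq_of_interpolates {f : H} (hf : ∀ i, f (x i) = kernelSum H x w (x i)) :
    ‖f‖ ^ 2 = ‖kernelSum H x w‖ ^ 2 + ‖f - kernelSum H x w‖ ^ 2 := by
  have h := norm_sq_eq_norm_kernelSum_sq_add x w f
  simpa only [hf, sub_self, mul_zero, Finset.sum_const_zero, add_zero] using h

lemma isEstimate_kernelSum (hlam : 0 ≤ lam)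
    (hw : ∀ i, kernelSum H x w (x i) + lam * w i = y i) :
    IsEstimate H lam x y (kernelSum H x w) := by
  rcases hlam.eq_or_lt' with rfl | hpos
  · simp only [zero_mul, add_zero] at hw
    refine .inr ⟨rfl, hw, fun h hh => ?_⟩
    have hnorm := norm_sq_eq_of_interpolates fun i => (hh i).trans (hw i).symm
    exact (sq_le_sq₀ (norm_nonneg _) (norm_nonneg _)).1
      (hnorm ▸ le_add_of_nonneg_right (sq_nonneg _))
  · refine .inl ⟨hpos, fun h => ?_⟩
    rw [ridge_objective_eq hw h]
    exact le_add_of_nonneg_right (by positivity)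

lemma IsEstimate.eq_kernelSum (hw : ∀ i, kernelSum H x w (x i) + lam * w i = y i) {f : H}
    (hf : IsEstimate H lam x y f) : f = kernelSum H x w := by
  rcases hf with ⟨hpos, hmin⟩ | ⟨rfl, hfy, hmin⟩
  · have hle := hmin (kernelSum H x w)
    rw [ridge_objective_eq hw f] at hle
    have hfit : 0 ≤ ∑ i, (f (x i) - kernelSum H x w (x i)) ^ 2 := by positivity
    have hzero : lam * ‖f - kernelSum H x w‖ ^ 2 ≤ 0 := by linarith
    have := nonpos_of_mul_nonpos_right hzero hpos
    exact sub_eq_zero.1 (norm_eq_zero.1 (pow_eq_zero_iff two_ne_zero |>.1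
      (this.antisymm (sq_nonneg _))))
  · simp only [zero_mul, add_zero] at hw
    have hnorm := norm_sq_eq_of_interpolates fun i => (hfy i).trans (hw i).symm
    have hle := pow_le_pow_left₀ (norm_nonneg _) (hmin _ hw) 2
    have : ‖f - kernelSum H x w‖ ^ 2 ≤ 0 := by linarith
    exact sub_eq_zero.1 (norm_eq_zero.1 (pow_eq_zero_iff two_ne_zero |>.1
      (this.antisymm (sq_nonneg _))))

lemma estimator_eq_kernelSum (hlam : 0 ≤ lam)
    (hw : ∀ i, kernelSum H x w (x i) + lam * w i = y i) :
    estimator H lam x y = kernelSum H x w := by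
  have hex : ∃ f : H, IsEstimate H lam x y f := ⟨_, isEstimate_kernelSum hlam hw⟩
  rw [estimator, dif_pos hex]
  exact hex.choose_spec.eq_kernelSum hw

end Representer

section Ridge

variable {d n : ℕ} {𝒳 : Set (E d)} {g : ℝ → ℝ → ℝ → ℝ} {τ lam : ℝ} {x : Fin n → 𝒳}

/-- The regularised kernel matrix `K + λ I`. -/
abbrev ridgeMatrix (g : ℝ → ℝ → ℝ → ℝ) (τ lam : ℝ) (x : Fin n → 𝒳) : Matrix (Fin n) (Fin n) ℝ :=
  kernelMatrix g τ x + lam • (1 : Matrix (Fin n) (Fin n) ℝ)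

/-- The coefficients `(K + λ I)⁻¹ F`, with `F i = f⋆(x i)`, of the averaged estimator in terms of
the kernel functions at the inputs. -/
def avgCoeff (g : ℝ → ℝ → ℝ → ℝ) (τ : ℝ) (ρ : Measure (𝒳 × ℝ)) [IsFiniteMeasure ρ] (lam : ℝ)
    (x : Fin n → 𝒳) : Fin n → ℝ :=
  (ridgeMatrix g τ lam x)⁻¹ *ᵥ fun i => groundTruth ρ (x i)

variable {H : Type*} [NormedAddCommGroup H] [InnerProductSpace ℝ H] [CompleteSpace H]
  [RKHS ℝ H 𝒳 ℝ] (hH : ∀ x x' : 𝒳, RKHS.kernel H x x' 1 = scaledKernel g τ x.1 x'.1)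
include hH

lemma scaledKernel_comm (x x' : 𝒳) :
    scaledKernel g τ x.1 x'.1 = scaledKernel g τ x'.1 x.1 := by
  have h := (RKHS.kernel_inner H x x' 1 1).trans
    ((real_inner_comm _ _).trans (RKHS.kernel_inner H x' x 1 1).symm)
  simpa [hH] using h

lemma isHermitian_ridgeMatrix (lam : ℝ) (x : Fin n → 𝒳) : (ridgeMatrix g τ lam x).IsHermitian :=
  .add (.ext fun _ _ => scaledKernel_comm hH _ _) (by simp [Matrix.IsHermitian])

lemma kernelSum_apply (x : Fin n → 𝒳) (w : Fin n → ℝ) (z : 𝒳) :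
    kernelSum H x w z = ∑ i, w i * scaledKernel g τ (x i).1 z.1 := by
  have h := inner_kernelSum x w (RKHS.kerFun H z 1)
  simpa [RKHS.kerFun_apply, hH] using h

lemma estimator_apply_eq_sum (hlam : 0 ≤ lam) (hdet : IsUnit (ridgeMatrix g τ lam x).det)
    (y : Fin n → ℝ) (z : 𝒳) : estimator H lam x y z =
      ∑ i, ((ridgeMatrix g τ lam x)⁻¹ *ᵥ y) i * scaledKernel g τ (x i).1 z.1 := by
  rw [← kernelSum_apply hH, estimator_eq_kernelSum hlam fun i => ?_]
  have hsolve : ridgeMatrix g τ lam x *ᵥ (ridgeMatrix g τ lam x)⁻¹ *ᵥ y = y := by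
    rw [Matrix.mulVec_mulVec, Matrix.mul_nonsing_inv _ hdet, Matrix.one_mulVec]
  generalize (ridgeMatrix g τ lam x)⁻¹ *ᵥ y = w at hsolve ⊢
  rw [← hsolve, Matrix.add_mulVec, Matrix.smul_mulVec, Matrix.one_mulVec, kernelSum_apply hH]
  simp only [Pi.add_apply, Pi.smul_apply, smul_eq_mul, mulVec, dotProduct, kernelMatrix,
    Matrix.of_apply, scaledKernel_comm hH (x i), mul_comm (w _)]

lemma avgEstimator_eq_sum (hlam : 0 ≤ lam) (hdet : IsUnit (ridgeMatrix g τ lam x).det)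
    (ρ : Measure (𝒳 × ℝ)) [IsFiniteMeasure ρ]
    (hintegrable : ∀ i, Integrable (fun y => y) (ρ.condKernel (x i))) (z : 𝒳) :
    avgEstimator H ρ lam x z = ∑ i, avgCoeff g τ ρ lam x i * scaledKernel g τ (x i).1 z.1 := by
  have hintegrable' (i : Fin n) : Integrable (fun y : Fin n → ℝ => y i)
      (Measure.pi fun i => ρ.condKernel (x i)) :=
    integrable_comp_eval (μ := fun i => ρ.condKernel (x i)) (hintegrable i)
  have hmean (i : Fin n) : ∫ y, y i ∂(Measure.pi fun i => ρ.condKernel (x i)) =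
      groundTruth ρ (x i) :=
    integral_comp_eval (μ := fun i => ρ.condKernel (x i)) (f := fun y : ℝ => y) (by fun_prop)
  have hint_mulVec (i j : Fin n) := (hintegrable' j).const_mul ((ridgeMatrix g τ lam x)⁻¹ i j)
  simp only [avgEstimator, estimator_apply_eq_sum hH hlam hdet, avgCoeff, mulVec, dotProduct]
  rw [integral_finsetSum _ fun i _ =>
    (integrable_finsetSum _ fun j _ => hint_mulVec i j).mul_const _]
  refine Finset.sum_congr rfl fun i _ => ?_
  rw [integral_mul_const, integral_finsetSum _ fun j _ => hint_mulVec i j]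
  simp only [integral_const_mul, hmean]

end Ridge

lemma abs_inner_div_le {d : ℕ} {τ : ℝ} (hτ : 0 < τ) {x z : E d} (hx : ‖x‖ ^ 2 / τ ≤ 2) :
    |inner ℝ x z / τ| ≤ 1 + ‖z‖ ^ 2 / τ := by
  have hinner := abs_real_inner_le_norm x z
  have hmul : (1 + ‖z‖ ^ 2 / τ) * τ = τ + ‖z‖ ^ 2 := by field_simp
  rw [div_le_iff₀ hτ] at hx
  rw [abs_div, abs_of_pos hτ, div_le_iff₀ hτ, hmul]
  nlinarith [sq_nonneg (‖x‖ - ‖z‖), sq_nonneg ‖z‖]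

namespace KernelApprox

variable {model : InputModel} {q m d n : ℕ} {g : ℝ → ℝ → ℝ → ℝ} (A : KernelApprox model q m g)
  {τ : ℝ}

/-- The polynomial in `z` that approximates the kernel function `scaledKernel g τ x z`. -/
def poly (τ : ℝ) (x : E d) : MvPolynomial (Fin d) ℝ :=
  ∑ e ∈ A.index, MvPolynomial.C (A.coeff e (‖x‖ ^ 2 / τ)) *
    ((MvPolynomial.C τ⁻¹ * ∑ j, MvPolynomial.C (x j) * MvPolynomial.X j) ^ e.1 *
      (MvPolynomial.C τ⁻¹ * ∑ j, MvPolynomial.X j ^ 2 - MvPolynomial.C 1) ^ e.2)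

lemma polyEval_poly (τ : ℝ) (x z : E d) : polyEval (A.poly τ x) z =
    ∑ e ∈ A.index, A.coeff e (‖x‖ ^ 2 / τ) *
      ((inner ℝ x z / τ) ^ e.1 * (‖z‖ ^ 2 / τ - 1) ^ e.2) := by
  have hinner : inner ℝ x z = ∑ j, x j * z j := by
    simp [EuclideanSpace.inner_eq_star_dotProduct, dotProduct, mul_comm]
  simp only [polyEval, poly, map_sum, map_mul, map_pow, map_sub, MvPolynomial.eval_C,
    MvPolynomial.eval_X, hinner, EuclideanSpace.real_norm_sq_eq z, div_eq_inv_mul]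

lemma totalDegree_poly_le (τ : ℝ) (x : E d) : (A.poly τ x).totalDegree ≤ m := by
  have hC {c : ℝ} {p : MvPolynomial (Fin d) ℝ} {k : ℕ} (hp : p.totalDegree ≤ k) :
      (MvPolynomial.C c * p).totalDegree ≤ k :=
    (MvPolynomial.totalDegree_mul _ _).trans (by simpa using hp)
  have hlin : (MvPolynomial.C τ⁻¹ * ∑ j, MvPolynomial.C (x j) * MvPolynomial.X j :
      MvPolynomial (Fin d) ℝ).totalDegree ≤ 1 :=
    hC (MvPolynomial.totalDegree_finsetSum_le fun j _ => hC (MvPolynomial.totalDegree_X j).le)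
  have hquad : (MvPolynomial.C τ⁻¹ * ∑ j, MvPolynomial.X j ^ 2 - MvPolynomial.C 1 :
      MvPolynomial (Fin d) ℝ).totalDegree ≤ 2 :=
    (MvPolynomial.totalDegree_sub _ _).trans <| max_le
      (hC (MvPolynomial.totalDegree_finsetSum_le fun j _ =>
        (MvPolynomial.totalDegree_X_pow j 2).le)) (by simp)
  refine MvPolynomial.totalDegree_finsetSum_le fun e he => hC ?_
  calc _ ≤ e.1 * 1 + e.2 * 2 := (MvPolynomial.totalDegree_mul _ _).trans <| add_le_add
        ((MvPolynomial.totalDegree_pow _ _).trans (by gcongr))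
        ((MvPolynomial.totalDegree_pow _ _).trans (by gcongr))
    _ ≤ m := by linarith [A.degree_le e he]

lemma abs_polyEval_poly_le (hτ : 0 < τ) {x : E d} (hx : |‖x‖ ^ 2 / τ - 1| ≤ A.radius) (z : E d) :
    |polyEval (A.poly τ x) z| ≤ A.index.card * A.bound * (1 + ‖z‖ ^ 2 / τ) ^ m := by
  have hz : 0 ≤ ‖z‖ ^ 2 / τ := by positivity
  have hinner := abs_inner_div_le hτ (z := z)
    (show ‖x‖ ^ 2 / τ ≤ 2 by linarith [(abs_le.1 hx).2, A.radius_le_one])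
  have hnorm : |‖z‖ ^ 2 / τ - 1| ≤ 1 + ‖z‖ ^ 2 / τ := abs_le.2 ⟨by linarith, by linarith⟩
  have hbound := A.bound_nonneg
  rw [polyEval_poly, mul_assoc, ← nsmul_eq_mul]
  refine (Finset.abs_sum_le_sum_abs _ _).trans (Finset.sum_le_card_nsmul _ _ _ fun e he => ?_)
  rw [abs_mul, abs_mul, abs_pow, abs_pow]
  calc _ ≤ A.bound * ((1 + ‖z‖ ^ 2 / τ) ^ e.1 * (1 + ‖z‖ ^ 2 / τ) ^ e.2) := by
        gcongr
        exact A.abs_coeff_le e he _ hx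
    _ = A.bound * (1 + ‖z‖ ^ 2 / τ) ^ (e.1 + e.2) := by rw [pow_add]
    _ ≤ A.bound * (1 + ‖z‖ ^ 2 / τ) ^ m := by
        gcongr
        exacts [le_add_of_nonneg_right hz, by linarith [A.degree_le e he]]

/-- The polynomial in `z` that approximates the kernel expansion
`∑ i, α i * scaledKernel g τ (x i) z`. -/
def approxPoly (τ : ℝ) (α : Fin n → ℝ) (x : Fin n → E d) : MvPolynomial (Fin d) ℝ :=
  ∑ i, MvPolynomial.C (α i) * A.poly τ (x i)

lemma polyEval_approxPoly (τ : ℝ) (α : Fin n → ℝ) (x : Fin n → E d) (z : E d) :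
    polyEval (A.approxPoly τ α x) z = ∑ i, α i * polyEval (A.poly τ (x i)) z := by
  simp [polyEval, approxPoly]

lemma approxPoly_mem_polySpace (τ : ℝ) (α : Fin n → ℝ) (x : Fin n → E d) :
    A.approxPoly τ α x ∈ polySpace d m :=
  MvPolynomial.totalDegree_finsetSum_le fun i _ =>
    (MvPolynomial.totalDegree_mul _ _).trans (by simpa using A.totalDegree_poly_le τ (x i))

variable {α : Fin n → ℝ} {L : ℝ} (hα : ∑ i, |α i| ≤ L) {x : Fin n → E d}
include hα

lemma abs_polyEval_approxPoly_le (hτ : 0 < τ) (hx : ∀ i, |‖x i‖ ^ 2 / τ - 1| ≤ A.radius)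
    (z : E d) : |polyEval (A.approxPoly τ α x) z| ≤
      L * (A.index.card * A.bound * (1 + ‖z‖ ^ 2 / τ) ^ m) := by
  have := A.bound_nonneg
  rw [polyEval_approxPoly]
  calc |∑ i, α i * polyEval (A.poly τ (x i)) z|
      ≤ ∑ i, |α i| * (A.index.card * A.bound * (1 + ‖z‖ ^ 2 / τ) ^ m) := by
        refine (Finset.abs_sum_le_sum_abs _ _).trans (Finset.sum_le_sum fun i _ => ?_)
        rw [abs_mul]
        gcongr
        exact A.abs_polyEval_poly_le hτ (hx i) z
    _ = (∑ i, |α i|) * _ := (Finset.sum_mul ..).symm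
    _ ≤ L * (A.index.card * A.bound * (1 + ‖z‖ ^ 2 / τ) ^ m) := by gcongr

lemma abs_sum_scaledKernel_sub_approxPoly_le {η : ℝ} (hη0 : 0 ≤ η) (hη : η ≤ A.radius)
    (hx : ∀ i, NormGood model A.radius (‖x i‖ ^ 2 / τ)) {z : E d}
    (hz : NormGood model η (‖z‖ ^ 2 / τ)) (hxz : ∀ i, |inner ℝ (x i) z / τ| ≤ η) :
    |∑ i, α i * scaledKernel g τ (x i) z - polyEval (A.approxPoly τ α x) z| ≤
      L * (A.bound * η ^ (q + 1)) := by
  have := A.bound_nonneg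
  rw [polyEval_approxPoly, ← Finset.sum_sub_distrib]
  calc |∑ i, (α i * scaledKernel g τ (x i) z - α i * polyEval (A.poly τ (x i)) z)|
      ≤ ∑ i, |α i| * (A.bound * η ^ (q + 1)) := by
        refine (Finset.abs_sum_le_sum_abs _ _).trans (Finset.sum_le_sum fun i _ => ?_)
        rw [← mul_sub, abs_mul, polyEval_poly]
        gcongr
        exact A.abs_sub_le η hη _ _ _ (hx i) hz (hxz i)
    _ = (∑ i, |α i|) * _ := (Finset.sum_mul ..).symm
    _ ≤ L * (A.bound * η ^ (q + 1)) := by gcongr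

end KernelApprox

section Asymptotics

lemma tendsto_pow_mul_exp_neg_rpow {κ γ : ℝ} (hκ : 0 < κ) (hγ : 0 < γ) (k : ℕ) :
    Tendsto (fun n : ℕ => (n : ℝ) ^ k * Real.exp (-(κ * (n : ℝ) ^ γ))) atTop (𝓝 0) := by
  refine ((tendsto_rpow_mul_exp_neg_mul_atTop_nhds_zero (k / γ) κ hκ).comp
    ((tendsto_rpow_atTop hγ).comp tendsto_natCast_atTop_atTop)).congr fun n => ?_
  simp only [Function.comp_apply]
  rw [← Real.rpow_mul n.cast_nonneg, mul_div_cancel₀ _ hγ.ne', Real.rpow_natCast, neg_mul]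

lemma summable_mul_exp_neg_rpow {κ γ : ℝ} (hκ : 0 < κ) (hγ : 0 < γ) :
    Summable (fun n : ℕ => (n : ℝ) * Real.exp (-(κ * (n : ℝ) ^ γ))) := by
  refine .of_norm_bounded_eventually_nat (Real.summable_one_div_nat_pow.2 one_lt_two) ?_
  filter_upwards [(tendsto_pow_mul_exp_neg_rpow hκ hγ 3).eventually (gt_mem_nhds one_pos),
    eventually_gt_atTop 0] with n hn hn0
  have : (0 : ℝ) < n := mod_cast hn0
  rw [Real.norm_of_nonneg (by positivity), le_div_iff₀ (by positivity)]
  linarith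

/-- The bound `(n + 1) K exp (-κ n ^ γ)` for the probability of the exceptional inputs. -/
def stretchedExp (K κ γ : ℝ) (n : ℕ) : ℝ := (n + 1) * K * Real.exp (-(κ * (n : ℝ) ^ γ))

lemma stretchedExp_nonneg {K : ℝ} (hK : 0 ≤ K) (κ γ : ℝ) (n : ℕ) : 0 ≤ stretchedExp K κ γ n :=
  mul_nonneg (by positivity) (Real.exp_pos _).le

lemma tendsto_pow_mul_stretchedExp (K : ℝ) {κ γ : ℝ} (hκ : 0 < κ) (hγ : 0 < γ) (k : ℕ) :
    Tendsto (fun n : ℕ => (n : ℝ) ^ k * stretchedExp K κ γ n) atTop (𝓝 0) := by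
  have h := ((tendsto_pow_mul_exp_neg_rpow hκ hγ (k + 1)).add
    (tendsto_pow_mul_exp_neg_rpow hκ hγ k)).mul_const K
  rw [add_zero, zero_mul] at h
  refine h.congr fun n => ?_
  unfold stretchedExp
  ring

lemma tendsto_mul_stretchedExp_rpow {K κ γ : ℝ} (hK : 0 ≤ K) (hκ : 0 < κ) (hγ : 0 < γ) (D : ℝ) :
    Tendsto (fun n : ℕ => n * D * stretchedExp K κ γ n ^ (1 / 4 : ℝ)) atTop (𝓝 0) := by
  have h := ((tendsto_pow_mul_stretchedExp K hκ hγ 4).rpow_const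
    (p := 1 / 4) (.inr (by norm_num))).mul_const D
  rw [Real.zero_rpow (by norm_num), zero_mul] at h
  refine h.congr fun n => ?_
  rw [Real.mul_rpow (by positivity) (stretchedExp_nonneg hK κ γ n), ← Real.rpow_natCast,
    ← Real.rpow_mul n.cast_nonneg]
  norm_num
  ring

lemma eventually_stretchedExp_le (K : ℝ) {κ γ : ℝ} (hκ : 0 < κ) (hγ : 0 < γ) (r : ℝ) :
    ∀ᶠ n : ℕ in atTop, stretchedExp K κ γ n ≤ (n : ℝ) ^ 2 * Real.exp (-Real.log n ^ r) := by
  have hlog := ((isLittleO_log_rpow_rpow_atTop r hγ).comp_tendsto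
    (tendsto_natCast_atTop_atTop (R := ℝ))).def (half_pos hκ)
  filter_upwards [hlog, eventually_ge_atTop 1,
    (tendsto_pow_mul_stretchedExp K (half_pos hκ) hγ 0).eventually (gt_mem_nhds one_pos)]
    with n hlog hn hsmall
  rw [pow_zero, one_mul] at hsmall
  have hn1 : (1 : ℝ) ≤ n := mod_cast hn
  have hlog' : Real.log n ^ r ≤ κ / 2 * (n : ℝ) ^ γ := by
    simpa [abs_of_nonneg (Real.rpow_nonneg n.cast_nonneg γ)] using (le_abs_self _).trans hlog
  calc stretchedExp K κ γ n
      = stretchedExp K (κ / 2) γ n * Real.exp (-(κ / 2 * (n : ℝ) ^ γ)) := by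
        rw [stretchedExp, stretchedExp, mul_assoc _ (Real.exp _), ← Real.exp_add]
        ring_nf
    _ ≤ 1 * Real.exp (-Real.log n ^ r) := by gcongr
    _ ≤ (n : ℝ) ^ 2 * Real.exp (-Real.log n ^ r) := by
        gcongr
        exact one_le_pow₀ hn1

lemma tendsto_mul_rpow_neg_pow {b : ℝ} {k : ℕ} (hb : 1 < b * k) :
    Tendsto (fun n : ℕ => n * ((n : ℝ) ^ (-b)) ^ k) atTop (𝓝 0) := by
  refine ((tendsto_rpow_neg_atTop (sub_pos.2 hb)).comp
    tendsto_natCast_atTop_atTop).congr' ?_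
  filter_upwards [eventually_gt_atTop 0] with n hn
  have hn0 : (0 : ℝ) < n := mod_cast hn
  rw [Function.comp_apply, ← Real.rpow_natCast, ← Real.rpow_mul hn0.le, neg_sub, sub_eq_add_neg,
    Real.rpow_add hn0, Real.rpow_one, neg_mul]

lemma eventually_mul_rpow_le_of_tendsto_div {β c₀ : ℝ} (hc₀ : 0 < c₀) {τ : ℕ → ℝ}
    (hτ : Tendsto (fun n : ℕ => τ n / (n : ℝ) ^ β) atTop (𝓝 c₀)) :
    ∀ᶠ n : ℕ in atTop, c₀ / 2 * (n : ℝ) ^ β ≤ τ n := by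
  filter_upwards [hτ.eventually (lt_mem_nhds (half_lt_self hc₀)), eventually_gt_atTop 0]
    with n h hn
  have : (0 : ℝ) < n := mod_cast hn
  exact ((lt_div_iff₀ (by positivity)).1 h).le

lemma exists_accuracy {β c₀ : ℝ} (hβ : 0 < β) (hc₀ : 0 < c₀) {τ : ℕ → ℝ}
    (hτ : Tendsto (fun n : ℕ => τ n / (n : ℝ) ^ β) atTop (𝓝 c₀)) :
    ∃ η : ℕ → ℝ, (∀ n, 0 ≤ η n) ∧ Tendsto η atTop (𝓝 0) ∧
      Tendsto (fun n : ℕ => n * η n ^ (⌊2 / β⌋₊ + 1)) atTop (𝓝 0) ∧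
      ∃ κ > (0 : ℝ), ∃ γ > (0 : ℝ), ∀ᶠ n : ℕ in atTop,
        0 < τ n ∧ κ * (n : ℝ) ^ γ ≤ η n * √(τ n) := by
  have hq : 2 / β < (⌊2 / β⌋₊ + 1 : ℕ) := by
    push_cast
    exact Nat.lt_floor_add_one _
  -- `η n = n ^ (-b)` is fine enough for the remainder of the kernel expansion when
  -- `1 / (⌊2 / β⌋ + 1) < b`, and coarse enough for concentration at scale `√τ` when `b < β / 2`.
  obtain ⟨b, hqb, hbβ⟩ : ∃ b, 1 / ((⌊2 / β⌋₊ + 1 : ℕ) : ℝ) < b ∧ b < β / 2 := by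
    apply exists_between
    rw [div_lt_iff₀ hβ] at hq
    rw [div_lt_div_iff₀ (by positivity) two_pos]
    linarith
  refine ⟨fun n => (n : ℝ) ^ (-b), fun n => by positivity,
    (tendsto_rpow_neg_atTop (lt_trans (by positivity) hqb)).comp tendsto_natCast_atTop_atTop,
    tendsto_mul_rpow_neg_pow ((div_lt_iff₀ (by positivity)).1 hqb),
    √(c₀ / 2), by positivity, β / 2 - b, sub_pos.2 hbβ, ?_⟩
  filter_upwards [eventually_mul_rpow_le_of_tendsto_div hc₀ hτ, eventually_gt_atTop 0]
    with n hn hn0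
  have hn0 : (0 : ℝ) < n := mod_cast hn0
  refine ⟨lt_of_lt_of_le (by positivity) hn, ?_⟩
  calc √(c₀ / 2) * (n : ℝ) ^ (β / 2 - b) = (n : ℝ) ^ (-b) * √(c₀ / 2 * (n : ℝ) ^ β) := by
        rw [Real.sqrt_mul (by positivity), Real.sqrt_eq_rpow ((n : ℝ) ^ β), ← Real.rpow_mul hn0.le,
          mul_left_comm, ← Real.rpow_add hn0]
        ring_nf
    _ ≤ (n : ℝ) ^ (-b) * √(τ n) := by gcongr

end Asymptotics

lemma ae_eventually_forall_notMem {Ω : Type*} [MeasurableSpace Ω] {μ : Measure Ω}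
    {𝒴 : ℕ → Type*} [∀ n, MeasurableSpace (𝒴 n)] {P : (n : ℕ) → Measure (𝒴 n)}
    {X : (n : ℕ) → Fin n → Ω → 𝒴 n} (hX : ∀ n i, HasLaw (X n i) (P n) μ)
    {s : (n : ℕ) → Set (𝒴 n)} (hs : ∀ n, MeasurableSet (s n)) {p : ℕ → ℝ}
    (hp : Summable fun n : ℕ => n * p n) (hle : ∀ᶠ n in atTop, P n (s n) ≤ ENNReal.ofReal (p n)) :
    ∀ᵐ ω ∂μ, ∀ᶠ n in atTop, ∀ i, X n i ω ∉ s n := by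
  obtain ⟨N, hN⟩ := eventually_atTop.1 hle
  have hunion (n : ℕ) (hn : N ≤ n) :
      μ (⋃ i, X n i ⁻¹' s n) ≤ ENNReal.ofReal (n * p n) := by
    calc μ (⋃ i, X n i ⁻¹' s n) ≤ ∑ i, μ (X n i ⁻¹' s n) := measure_iUnion_fintype_le _ _
      _ = ∑ _i : Fin n, P n (s n) := Finset.sum_congr rfl fun i _ => by
        rw [← (hX n i).map_eq, Measure.map_apply_of_aemeasurable (hX n i).aemeasurable (hs n)]
      _ ≤ ENNReal.ofReal (n * p n) := by
        rw [Finset.sum_const, Finset.card_univ, Fintype.card_fin, nsmul_eq_mul,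
          ENNReal.ofReal_mul n.cast_nonneg, ENNReal.ofReal_natCast]
        gcongr
        exact hN n hn
  have hsum : ∑' n, μ (⋃ i, X (n + N) i ⁻¹' s (n + N)) ≠ ∞ :=
    ne_top_of_le_ne_top ((summable_nat_add_iff N).2 hp).tsum_ofReal_ne_top
      (ENNReal.tsum_le_tsum fun n => hunion _ (Nat.le_add_left N n))
  filter_upwards [ae_eventually_notMem hsum] with ω hω
  rw [← map_add_atTop_eq_nat N, eventually_map]
  simpa only [Set.mem_iUnion, not_exists, Set.mem_preimage] using hω

section CloseOffSmallSet

variable {α : Type*} [MeasurableSpace α] {P : Measure α}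

lemma eLpNorm_le_restrict_add_restrict_compl {f : α → ℝ} (hf : AEStronglyMeasurable f P)
    {s : Set α} (hs : MeasurableSet s) {p : ℝ≥0∞} (hp : 1 ≤ p) :
    eLpNorm f p P ≤ eLpNorm f p (P.restrict s) + eLpNorm f p (P.restrict sᶜ) := by
  rw [← eLpNorm_indicator_eq_eLpNorm_restrict hs,
    ← eLpNorm_indicator_eq_eLpNorm_restrict hs.compl]
  conv_lhs => rw [← Set.indicator_self_add_compl s f]
  exact eLpNorm_add_le (hf.indicator hs) (hf.indicator hs.compl) hp

lemma eLpNorm_two_restrict_le {f : α → ℝ} (hf : AEStronglyMeasurable f P) (s : Set α) :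
    eLpNorm f 2 (P.restrict s) ≤ eLpNorm f 4 P * P s ^ (1 / 4 : ℝ) := by
  refine (eLpNorm_le_eLpNorm_mul_rpow_measure_univ (p := 2) (q := 4) (by norm_num)
    hf.restrict).trans ?_
  rw [Measure.restrict_apply_univ, ENNReal.toReal_ofNat, ENNReal.toReal_ofNat,
    show (1 / 2 - 1 / 4 : ℝ) = 1 / 4 by norm_num]
  gcongr
  exact Measure.restrict_le_self

/-- `f` is within `e` of `p` outside a set of measure at most `b`, and the `L⁴` norm of `p` is at
most `L`. -/
structure CloseOffSmallSet (P : Measure α) (e : ℝ) (b L : ℝ≥0∞) (f p : α → ℝ) : Prop where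
  aestronglyMeasurable_left : AEStronglyMeasurable f P
  aestronglyMeasurable_right : AEStronglyMeasurable p P
  exists_measurableSet : ∃ s, MeasurableSet s ∧ P sᶜ ≤ b ∧ ∀ z ∈ s, |f z - p z| ≤ e
  eLpNorm_le : eLpNorm p 4 P ≤ L

namespace CloseOffSmallSet

variable {e : ℝ} {b L : ℝ≥0∞} {f p : α → ℝ}

lemma mono (h : CloseOffSmallSet P e b L f p) {b' : ℝ≥0∞} (hb : b ≤ b') :
    CloseOffSmallSet P e b' L f p where
  __ := h
  exists_measurableSet :=
    h.exists_measurableSet.imp fun _ => And.imp_right (And.imp_left (·.trans hb))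

variable [IsProbabilityMeasure P]

lemma one_sub_le_measure (h : CloseOffSmallSet P e b L f p) :
    1 - b ≤ P {z | |f z - p z| ≤ e} := by
  obtain ⟨s, -, hb, he⟩ := h.exists_measurableSet
  rw [tsub_le_iff_right]
  calc 1 = P Set.univ := measure_univ.symm
    _ ≤ P s + P sᶜ := measure_univ_le_add_compl s
    _ ≤ P {z | |f z - p z| ≤ e} + b := by gcongr; exact he

lemma eLpNorm_two_sub_le (h : CloseOffSmallSet P e b L f p) {f₀ : α → ℝ}
    (hf₀ : AEStronglyMeasurable f₀ P) {B : ℝ} (hB : ∀ᵐ z ∂P, |f₀ z| ≤ B) :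
    eLpNorm (fun z => f₀ z - p z) 2 P ≤ eLpNorm (fun z => f z - f₀ z) 2 P +
      (ENNReal.ofReal e + (ENNReal.ofReal B + L) * b ^ (1 / 4 : ℝ)) := by
  have hf := h.aestronglyMeasurable_left
  have hp := h.aestronglyMeasurable_right
  obtain ⟨s, hs, hb, he⟩ := h.exists_measurableSet
  have hclose : eLpNorm (f - p) 2 (P.restrict s) ≤ ENNReal.ofReal e := by
    refine (eLpNorm_le_of_ae_bound (C := e) ?_).trans ?_
    · exact (ae_restrict_iff' hs).2 (.of_forall he)
    · refine mul_le_of_le_one_left' (ENNReal.rpow_le_one ?_ (by positivity))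
      rw [Measure.restrict_apply_univ]
      exact prob_le_one
  have hinside : eLpNorm (f₀ - p) 2 (P.restrict s) ≤ eLpNorm (f - f₀) 2 P + ENNReal.ofReal e := by
    rw [eLpNorm_sub_comm f, ← sub_add_sub_cancel f₀ f p]
    refine (eLpNorm_add_le (hf₀.sub hf).restrict (hf.sub hp).restrict one_le_two).trans ?_
    gcongr
    exact Measure.restrict_le_self
  have houtside : eLpNorm (f₀ - p) 2 (P.restrict sᶜ) ≤
      (ENNReal.ofReal B + L) * b ^ (1 / 4 : ℝ) := by
    refine (eLpNorm_two_restrict_le (hf₀.sub hp) _).trans ?_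
    gcongr
    refine (eLpNorm_sub_le hf₀ hp (by norm_num)).trans (add_le_add ?_ h.eLpNorm_le)
    simpa using eLpNorm_le_of_ae_bound (f := f₀) (p := 4) (C := B) hB
  calc eLpNorm (f₀ - p) 2 P ≤ _ :=
        eLpNorm_le_restrict_add_restrict_compl (hf₀.sub hp) hs one_le_two
    _ ≤ _ := add_le_add hinside houtside
    _ = _ := add_assoc _ _ _

end CloseOffSmallSet

end CloseOffSmallSet

lemma min_add_sq_le (y s B : ℝ≥0∞) :
    min ((y + s) ^ 2) (B ^ 2) ≤ y ^ 2 + (2 * B * s + s ^ 2) := by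
  rcases le_total B y with hy | hy
  · calc _ ≤ B ^ 2 := min_le_right _ _
      _ ≤ y ^ 2 := by gcongr
      _ ≤ _ := le_self_add
  · calc _ ≤ (y + s) ^ 2 := min_le_left _ _
      _ = y ^ 2 + (2 * y * s + s ^ 2) := by ring
      _ ≤ _ := by gcongr

section AsympClose

variable {α : ℕ → Type*} [∀ n, MeasurableSpace (α n)] {P : ∀ n, Measure (α n)}
  {f p : ∀ n, α n → ℝ}

/-- `f n` is close to `p n` in probability, with vanishing error, exceptional sets of
stretched-exponentially small measure, and `L⁴` norms of `p n` growing at most linearly. -/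
def AsympClose (P : ∀ n, Measure (α n)) (f p : ∀ n, α n → ℝ) : Prop :=
  ∃ (e : ℕ → ℝ) (K κ γ L : ℝ), 0 ≤ K ∧ 0 < κ ∧ 0 < γ ∧ Tendsto e atTop (𝓝 0) ∧
    ∀ᶠ n : ℕ in atTop, CloseOffSmallSet (P n) (e n) (ENNReal.ofReal (stretchedExp K κ γ n))
      (ENNReal.ofReal (n * L)) (f n) (p n)

namespace AsympClose

variable [∀ n, IsProbabilityMeasure (P n)]

lemma eventually_one_sub_le_measure (h : AsympClose P f p) {ε : ℝ} (hε : 0 < ε) (r : ℝ) :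
    ∀ᶠ n : ℕ in atTop, 1 - ENNReal.ofReal ((n : ℝ) ^ 2 * Real.exp (-Real.log n ^ r)) ≤
      P n {z | |f n z - p n z| ≤ ε} := by
  obtain ⟨e, K, κ, γ, L, -, hκ, hγ, he, h⟩ := h
  filter_upwards [h, he.eventually (ge_mem_nhds hε), eventually_stretchedExp_le K hκ hγ r]
    with n h he hexp
  calc _ ≤ 1 - ENNReal.ofReal (stretchedExp K κ γ n) := by gcongr
    _ ≤ P n {z | |f n z - p n z| ≤ e n} := h.one_sub_le_measure
    _ ≤ P n {z | |f n z - p n z| ≤ ε} := by gcongr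

lemma exists_eLpNorm_two_sub_le (h : AsympClose P f p) {f₀ : ∀ n, α n → ℝ}
    (hf₀ : ∀ᶠ n in atTop, AEStronglyMeasurable (f₀ n) (P n)) {B : ℝ}
    (hB : ∀ᶠ n : ℕ in atTop, ∀ᵐ z ∂P n, |f₀ n z| ≤ n * B) :
    ∃ s : ℕ → ℝ≥0∞, Tendsto s atTop (𝓝 0) ∧ ∀ᶠ n in atTop,
      eLpNorm (fun z => f₀ n z - p n z) 2 (P n) ≤
        eLpNorm (fun z => f n z - f₀ n z) 2 (P n) + s n := by
  obtain ⟨e, K, κ, γ, L, hK, hκ, hγ, he, h⟩ := h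
  refine ⟨_, ?_, by filter_upwards [h, hf₀, hB] with n h hf₀ hB using h.eLpNorm_two_sub_le hf₀ hB⟩
  have hlim (D : ℝ) : Tendsto (fun n : ℕ => ENNReal.ofReal (n * D) *
      ENNReal.ofReal (stretchedExp K κ γ n) ^ (1 / 4 : ℝ)) atTop (𝓝 0) := by
    rw [← ENNReal.ofReal_zero]
    refine (ENNReal.tendsto_ofReal (tendsto_mul_stretchedExp_rpow hK hκ hγ D)).congr fun n => ?_
    have hnonneg := stretchedExp_nonneg hK κ γ n
    rw [ENNReal.ofReal_mul' (Real.rpow_nonneg hnonneg _),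
      ENNReal.ofReal_rpow_of_nonneg hnonneg (by norm_num)]
  simpa [add_mul] using (ENNReal.tendsto_ofReal he).add ((hlim B).add (hlim L))

lemma tendsto_eLpNorm_sub (h : AsympClose P f p) {B : ℝ}
    (hB : ∀ᶠ n : ℕ in atTop, ∀ᵐ z ∂P n, |f n z| ≤ n * B) :
    Tendsto (fun n => eLpNorm (fun z => f n z - p n z) 2 (P n)) atTop (𝓝 0) := by
  have hf : ∀ᶠ n in atTop, AEStronglyMeasurable (f n) (P n) := by
    obtain ⟨e, K, κ, γ, L, -, -, -, -, h⟩ := h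
    exact h.mono fun n h => h.aestronglyMeasurable_left
  obtain ⟨s, hs, hle⟩ := h.exists_eLpNorm_two_sub_le hf hB
  refine tendsto_of_tendsto_of_tendsto_of_le_of_le' tendsto_const_nhds hs
    (.of_forall fun _ => zero_le) ?_
  simpa using hle

lemma eventually_min_eLpNorm_sq_le (h : AsympClose P f p) {f₀ : ∀ n, α n → ℝ}
    (hf₀ : ∀ n, AEStronglyMeasurable (f₀ n) (P n)) {B : ℝ}
    (hB : ∀ n, ∀ᵐ z ∂P n, |f₀ n z| ≤ B) {ε : ℝ} (hε : 0 < ε) : ∀ᶠ n in atTop,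
      min (eLpNorm (fun z => f₀ n z - p n z) 2 (P n) ^ 2) (eLpNorm (f₀ n) 2 (P n) ^ 2) ≤
        eLpNorm (fun z => f n z - f₀ n z) 2 (P n) ^ 2 + ENNReal.ofReal ε := by
  have hnB : ∀ᶠ n : ℕ in atTop, ∀ᵐ z ∂P n, |f₀ n z| ≤ n * |B| := by
    filter_upwards [eventually_ge_atTop 1] with n hn
    filter_upwards [hB n] with z hz
    exact (hz.trans (le_abs_self B)).trans (le_mul_of_one_le_left (abs_nonneg B) (mod_cast hn))
  obtain ⟨s, hs, hle⟩ := h.exists_eLpNorm_two_sub_le (.of_forall hf₀) hnB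
  have hslack : Tendsto (fun n => 2 * ENNReal.ofReal B * s n + s n ^ 2) atTop (𝓝 0) := by
    simpa using (ENNReal.Tendsto.const_mul hs (.inr (by finiteness))).add
      (ENNReal.Tendsto.pow (n := 2) hs)
  filter_upwards [hle, hslack.eventually (ge_mem_nhds (ENNReal.ofReal_pos.2 hε))] with n hle hε
  have hf₀B : eLpNorm (f₀ n) 2 (P n) ≤ ENNReal.ofReal B := by
    simpa using eLpNorm_le_of_ae_bound (f := f₀ n) (p := 2) (C := B) (hB n)
  calc _ ≤ min ((eLpNorm (fun z => f n z - f₀ n z) 2 (P n) + s n) ^ 2) (ENNReal.ofReal B ^ 2) := by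
        gcongr
    _ ≤ _ := min_add_sq_le _ _ _
    _ ≤ _ := by gcongr

end AsympClose

end AsympClose

section GoodSet

variable {d n : ℕ} {S : Matrix (Fin d) (Fin d) ℝ} {v : ℝ≥0} {ν : Measure ℝ} {model : InputModel}
  {η : ℝ} {x : Fin n → E d}

/-- The inputs whose norm, and whose inner products with the data inputs `x`, are so close to their
typical values that the kernel expansion at them has accuracy `η`. -/
def goodSet (model : InputModel) (τ η : ℝ) (x : Fin n → E d) : Set (E d) :=
  {z | NormGood model η (‖z‖ ^ 2 / τ) ∧ ∀ i, |inner ℝ (x i) z / τ| ≤ η}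

lemma measurableSet_goodSet (model : InputModel) (τ η : ℝ) (x : Fin n → E d) :
    MeasurableSet (goodSet model τ η x) := by
  refine .inter ((measurableSet_normGood model η).preimage
    (by fun_prop : Measurable fun z : E d => ‖z‖ ^ 2 / τ)) ?_
  exact measurableSet_setOfPred.2 (.forall fun i => measurableSet_setOfPred.1
    (measurableSet_le (by fun_prop) measurable_const))

lemma inputLaw_compl_goodSet_le (hS : S.PosSemidef) (hS1 : ‖S‖ = 1) (hτ : 0 < effDim S)
    (hν : IsSubgaussianUnitLaw v ν) (hv : 1 ≤ v) (hη0 : 0 ≤ η) (hη1 : η ≤ 1)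
    (hx : ∀ i, ‖x i‖ ^ 2 ≤ 2 * effDim S) :
    inputLaw model S ν (goodSet model (effDim S) η x)ᶜ ≤
      ENNReal.ofReal ((n + 1) * tailConst v * Real.exp (-(η * √(effDim S) / (32 * v)))) := by
  have hsub : (goodSet model (effDim S) η x)ᶜ ⊆
      {z | ¬ NormGood model η (‖z‖ ^ 2 / effDim S)} ∪
        ⋃ i, {z | η * effDim S ≤ |inner ℝ (x i) z|} := by
    intro z hz
    rw [goodSet, Set.mem_compl_iff, Set.mem_ofPred_eq, not_and_or, not_forall] at hz
    refine hz.imp_right fun ⟨i, hi⟩ => Set.mem_iUnion.2 ⟨i, ?_⟩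
    rw [abs_div, abs_of_pos hτ, div_le_iff₀ hτ] at hi
    exact (not_le.1 hi).le
  set y := tailConst v * Real.exp (-(η * √(effDim S) / (32 * v)))
  calc inputLaw model S ν (goodSet model (effDim S) η x)ᶜ
      ≤ inputLaw model S ν {z | ¬ NormGood model η (‖z‖ ^ 2 / effDim S)} +
        ∑ i, inputLaw model S ν {z | η * effDim S ≤ |inner ℝ (x i) z|} :=
        (measure_mono hsub).trans ((measure_union_le _ _).trans
          (add_le_add_right (measure_iUnion_fintype_le _ _) _))
    _ ≤ ENNReal.ofReal y + ∑ _i : Fin n, ENNReal.ofReal y := by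
        gcongr with i
        · exact inputLaw_not_normGood_le model hS hS1 hτ hν (one_pos.trans_le hv) hη0 hη1
        · exact inputLaw_abs_inner_le model hS hS1 hτ hν hv (hx i) hη0 hη1
    _ = ENNReal.ofReal ((n + 1) * tailConst v * Real.exp (-(η * √(effDim S) / (32 * v)))) := by
        rw [Finset.sum_const, Finset.card_univ, Fintype.card_fin, nsmul_eq_mul, mul_assoc,
          ENNReal.ofReal_mul (q := y) (by positivity), ENNReal.ofReal_add n.cast_nonneg zero_le_one,
          ENNReal.ofReal_natCast, ENNReal.ofReal_one]
        ring

lemma eLpNorm_four_one_add_pow_le (hS : S.PosSemidef) (hS1 : ‖S‖ = 1) (hτ : 0 < effDim S)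
    (hν : IsSubgaussianUnitLaw v ν) (hv : 0 < v) (m : ℕ) :
    eLpNorm (fun z : E d => (1 + ‖z‖ ^ 2 / effDim S) ^ m) 4 (inputLaw model S ν) ≤
      ENNReal.ofReal (momentConst v (m * 4) ^ (1 / 4 : ℝ)) := by
  have hM : 0 ≤ momentConst v (m * 4) := by
    unfold momentConst
    positivity
  rw [eLpNorm_eq_lintegral_rpow_enorm_toReal (by norm_num) (by norm_num),
    ← ENNReal.ofReal_rpow_of_nonneg hM (by norm_num), ENNReal.toReal_ofNat]
  gcongr
  refine le_trans (lintegral_mono fun z => le_of_eq ?_)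
    (lintegral_inputLaw_one_add_pow_le model hS hS1 hτ hν hv (m * 4))
  have : 0 ≤ 1 + ‖z‖ ^ 2 / effDim S := by positivity
  rw [Real.enorm_of_nonneg (by positivity), pow_mul, ENNReal.ofReal_pow (by positivity) 4]
  norm_cast

end GoodSet

section FixedSize

variable {d n : ℕ} {𝒳 : Set (E d)} {g : ℝ → ℝ → ℝ → ℝ} {model : InputModel} {τ δ B c lam : ℝ}
  {x : Fin n → 𝒳}

/-- The properties of the inputs `x` of a data set that the approximation of the averaged
estimator by a polynomial uses. -/
structure GoodData (model : InputModel) (ρ : Measure (𝒳 × ℝ)) [IsFiniteMeasure ρ]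
    (g : ℝ → ℝ → ℝ → ℝ) (τ δ B c lam : ℝ) (x : Fin n → 𝒳) : Prop where
  normGood : ∀ i, NormGood model δ (‖(x i).1‖ ^ 2 / τ)
  abs_groundTruth_le : ∀ i, |groundTruth ρ (x i)| ≤ B
  integrable : ∀ i, Integrable (fun y => y) (ρ.condKernel (x i))
  mem_support : ∀ i, x i ∈ ρ.fst.support
  le_eigenvalue : ∀ e ∈ spectrum ℝ (ridgeMatrix g τ lam x), c ≤ e

variable {ρ : Measure (𝒳 × ℝ)} {H : Type*} [NormedAddCommGroup H] [InnerProductSpace ℝ H]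
  [CompleteSpace H] [RKHS ℝ H 𝒳 ℝ]

namespace GoodData

section

variable [IsFiniteMeasure ρ] (hx : GoodData model ρ g τ δ B c lam x)
  (hH : ∀ x x' : 𝒳, RKHS.kernel H x x' 1 = scaledKernel g τ x.1 x'.1) (hc : 0 < c)
include hx hH hc

lemma sum_abs_avgCoeff_le (hB : 0 ≤ B) : ∑ i, |avgCoeff g τ ρ lam x i| ≤ n * (B / c) := by
  have h := sum_abs_inv_mulVec_le (isHermitian_ridgeMatrix hH lam x) hc hx.le_eigenvalue hB
    hx.abs_groundTruth_le
  rwa [Fintype.card_fin, mul_div_assoc] at h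

variable (hlam : 0 ≤ lam)
include hlam

lemma avgEstimator_eq_sum (z : 𝒳) : avgEstimator H ρ lam x z =
    ∑ i, avgCoeff g τ ρ lam x i * scaledKernel g τ (x i).1 z.1 :=
  PolyBarrier.avgEstimator_eq_sum hH hlam (isUnit_det_of_spectrum hc hx.le_eigenvalue) ρ
    hx.integrable z

lemma continuous_avgEstimator
    (hcont : Continuous fun p : 𝒳 × 𝒳 => scaledKernel g τ p.1.1 p.2.1) :
    Continuous (avgEstimator H ρ lam x) := by
  rw [funext (hx.avgEstimator_eq_sum hH hc hlam)]
  refine continuous_finsetSum _ fun i _ => .const_mul ?_ _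
  exact hcont.comp (f := fun z : 𝒳 => (x i, z)) (by fun_prop)

lemma abs_avgEstimator_le (hB : 0 ≤ B) {M : ℝ}
    (hM : ∀ x ∈ ρ.fst.support, ∀ x' ∈ ρ.fst.support, |scaledKernel g τ x.1 x'.1| ≤ M)
    {z : 𝒳} (hz : z ∈ ρ.fst.support) : |avgEstimator H ρ lam x z| ≤ n * (B / c * M) := by
  have hM₀ : 0 ≤ M := (abs_nonneg _).trans (hM z hz z hz)
  rw [hx.avgEstimator_eq_sum hH hc hlam]
  calc |∑ i, avgCoeff g τ ρ lam x i * scaledKernel g τ (x i).1 z.1|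
      ≤ ∑ i, |avgCoeff g τ ρ lam x i| * M := by
        refine (Finset.abs_sum_le_sum_abs _ _).trans (Finset.sum_le_sum fun i _ => ?_)
        rw [abs_mul]
        gcongr
        exact hM _ (hx.mem_support i) _ hz
    _ = (∑ i, |avgCoeff g τ ρ lam x i|) * M := (Finset.sum_mul ..).symm
    _ ≤ n * (B / c) * M := by
        gcongr
        exact hx.sum_abs_avgCoeff_le hH hc hB
    _ = n * (B / c * M) := mul_assoc ..

end

variable [IsFiniteMeasure ρ] {S : Matrix (Fin d) (Fin d) ℝ} {v : ℝ≥0} {ν : Measure ℝ} {q m : ℕ}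
  {A : KernelApprox model q m g} (hx : GoodData model ρ g (effDim S) A.radius B c lam x)
  (hH : ∀ x x' : 𝒳, RKHS.kernel H x x' 1 = scaledKernel g (effDim S) x.1 x'.1) (hc : 0 < c)
  (hB : 0 ≤ B) (hP : ρ.fst.map Subtype.val = inputLaw model S ν) (hS : S.PosSemidef)
  (hS1 : ‖S‖ = 1) (hτ : 0 < effDim S) (hν : IsSubgaussianUnitLaw v ν)
include hx hH hc hB hP hS hS1 hτ hν

lemma eLpNorm_approxPoly_le (hv : 0 < v) :
    eLpNorm (fun z : 𝒳 => polyEval (A.approxPoly (effDim S) (avgCoeff g (effDim S) ρ lam x)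
        fun i => (x i).1) z.1) 4 ρ.fst ≤
      ENNReal.ofReal (n * (B / c * (A.index.card * A.bound) *
        momentConst v (m * 4) ^ (1 / 4 : ℝ))) := by
  have := A.bound_nonneg
  set D := n * (B / c) * (A.index.card * A.bound) with hD
  have hmoment : eLpNorm (fun z : 𝒳 => (1 + ‖z.1‖ ^ 2 / effDim S) ^ m) 4 ρ.fst ≤
      ENNReal.ofReal (momentConst v (m * 4) ^ (1 / 4 : ℝ)) := by
    have h := eLpNorm_four_one_add_pow_le (model := model) hS hS1 hτ hν hv m
    rwa [← hP, eLpNorm_map_measure (by fun_prop) (by fun_prop)] at h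
  have hle (z : 𝒳) : ‖polyEval (A.approxPoly (effDim S) (avgCoeff g (effDim S) ρ lam x)
      fun i => (x i).1) z.1‖ ≤ D * ‖(1 + ‖z.1‖ ^ 2 / effDim S) ^ m‖ := by
    have : 0 ≤ 1 + ‖z.1‖ ^ 2 / effDim S := by positivity
    rw [Real.norm_eq_abs, Real.norm_of_nonneg (by positivity), hD, mul_assoc]
    exact A.abs_polyEval_approxPoly_le (hx.sum_abs_avgCoeff_le hH hc hB) hτ
      (fun i => (hx.normGood i).abs_sub_one_le A.radius_pos.le) z.1
  calc _ ≤ ENNReal.ofReal D * eLpNorm (fun z : 𝒳 => (1 + ‖z.1‖ ^ 2 / effDim S) ^ m) 4 ρ.fst :=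
        eLpNorm_le_mul_eLpNorm_of_ae_le_mul (.of_forall hle) 4
    _ ≤ ENNReal.ofReal D * ENNReal.ofReal (momentConst v (m * 4) ^ (1 / 4 : ℝ)) := by gcongr
    _ = _ := by
        rw [← ENNReal.ofReal_mul (by positivity), hD]
        ring_nf

lemma closeOffSmallSet_avgEstimator (hv : 1 ≤ v) (hlam : 0 ≤ lam)
    (hcont : Continuous fun p : 𝒳 × 𝒳 => scaledKernel g (effDim S) p.1.1 p.2.1) {η : ℝ}
    (hη0 : 0 ≤ η) (hη : η ≤ A.radius) :
    CloseOffSmallSet ρ.fst (n * (B / c) * (A.bound * η ^ (q + 1)))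
      (ENNReal.ofReal ((n + 1) * tailConst v * Real.exp (-(η * √(effDim S) / (32 * v)))))
      (ENNReal.ofReal (n * (B / c * (A.index.card * A.bound) *
        momentConst v (m * 4) ^ (1 / 4 : ℝ))))
      (avgEstimator H ρ lam x)
      (fun z => polyEval (A.approxPoly (effDim S) (avgCoeff g (effDim S) ρ lam x)
        fun i => (x i).1) z.1) where
  aestronglyMeasurable_left :=
    (hx.continuous_avgEstimator hH hc hlam hcont).aestronglyMeasurable
  aestronglyMeasurable_right := ((MvPolynomial.continuous_eval _).comp
    (by fun_prop : Continuous fun z : 𝒳 => fun j => z.1 j)).aestronglyMeasurable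
  exists_measurableSet := by
    have hgood := measurableSet_goodSet model (effDim S) η fun i => (x i).1
    have hnorm (i : Fin n) : ‖(x i).1‖ ^ 2 ≤ 2 * effDim S := by
      have h := (abs_le.1 ((hx.normGood i).abs_sub_one_le A.radius_pos.le)).2
      rw [← div_le_iff₀ hτ]
      linarith [A.radius_le_one]
    refine ⟨Subtype.val ⁻¹' _, measurable_subtype_coe hgood, ?_, fun z hz => ?_⟩
    · rw [← Set.preimage_compl, ← Measure.map_apply measurable_subtype_coe hgood.compl, hP]
      exact inputLaw_compl_goodSet_le hS hS1 hτ hν hv hη0 (hη.trans A.radius_le_one) hnorm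
    · rw [hx.avgEstimator_eq_sum hH hc hlam]
      exact A.abs_sum_scaledKernel_sub_approxPoly_le (hx.sum_abs_avgCoeff_le hH hc hB) hη0 hη
        hx.normGood hz.1 hz.2
  eLpNorm_le := hx.eLpNorm_approxPoly_le hH hc hB hP hS hS1 hτ hν (one_pos.trans_le hv)

end GoodData

end FixedSize

section Sequence

variable {β c₀ : ℝ} (hβ : 0 < β) (hc₀ : 0 < c₀) {model : InputModel} {d : ℕ → ℕ}
  {S : (n : ℕ) → Matrix (Fin (d n)) (Fin (d n)) ℝ} (hS : ∀ n, (S n).PosSemidef)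
  (hS1 : ∀ n, ‖S n‖ = 1)
  (hd : Tendsto (fun n : ℕ => effDim (S n) / (n : ℝ) ^ β) atTop (𝓝 c₀)) {v : ℝ≥0} (hv : 1 ≤ v)
  {ν : ℕ → Measure ℝ} (hν : ∀ n, IsSubgaussianUnitLaw v (ν n)) {𝒳 : (n : ℕ) → Set (E (d n))}
include hβ hc₀ hS hS1 hd hv hν

lemma ae_eventually_forall_normGood {P : (n : ℕ) → Measure (𝒳 n)}
    (hP : ∀ n, (P n).map Subtype.val = inputLaw model (S n) (ν n)) {Ω : Type*}
    [MeasurableSpace Ω] {μ : Measure Ω} {X : (n : ℕ) → Fin n → Ω → 𝒳 n}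
    (hX : ∀ n i, HasLaw (X n i) (P n) μ) {δ : ℝ} (hδ : 0 < δ) :
    ∀ᵐ ω ∂μ, ∀ᶠ n in atTop, ∀ i, NormGood model δ (‖(X n i ω).1‖ ^ 2 / effDim (S n)) := by
  have : (0 : ℝ) < v := one_pos.trans_le hv
  have := tailConst_nonneg v
  obtain ⟨η, hη0, hη, -, κ, hκ, γ, hγ, hη_ge⟩ := exists_accuracy hβ hc₀ hd
  have hmeas (n : ℕ) : MeasurableSet {z : E (d n) | ¬ NormGood model δ (‖z‖ ^ 2 / effDim (S n))} :=
    (measurableSet_normGood model δ).compl.preimage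
      (by fun_prop : Measurable fun z : E (d n) => ‖z‖ ^ 2 / effDim (S n))
  have hbad : ∀ᶠ n : ℕ in atTop, P n (Subtype.val ⁻¹'
      {z | ¬ NormGood model δ (‖z‖ ^ 2 / effDim (S n))}) ≤
        ENNReal.ofReal (tailConst v * Real.exp (-(κ / (32 * v) * (n : ℝ) ^ γ))) := by
    filter_upwards [hη_ge, hη.eventually (ge_mem_nhds (lt_min hδ one_pos))] with n ⟨hτ, hκη⟩ hηδ
    rw [← Measure.map_apply measurable_subtype_coe (hmeas n), hP]
    calc _ ≤ inputLaw model (S n) (ν n) {z | ¬ NormGood model (η n) (‖z‖ ^ 2 / effDim (S n))} :=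
          measure_mono fun z (hz : ¬ NormGood model δ _) (h : NormGood model (η n) _) =>
            hz (h.mono (hηδ.trans (min_le_left _ _)))
      _ ≤ _ := inputLaw_not_normGood_le model (hS n) (hS1 n) hτ (hν n) (one_pos.trans_le hv)
          (hη0 n) (hηδ.trans (min_le_right _ _))
      _ ≤ _ := by
          rw [div_mul_eq_mul_div]
          gcongr
  have hsum : Summable fun n : ℕ =>
      n * (tailConst v * Real.exp (-(κ / (32 * v) * (n : ℝ) ^ γ))) := by
    simpa only [mul_left_comm] using
      (summable_mul_exp_neg_rpow (show 0 < κ / (32 * v) by positivity) hγ).mul_left (tailConst v)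
  simpa using ae_eventually_forall_notMem hX (fun n => measurable_subtype_coe (hmeas n)) hsum hbad

variable {g : ℝ → ℝ → ℝ → ℝ} {ρ : (n : ℕ) → Measure (𝒳 n × ℝ)} [∀ n, IsFiniteMeasure (ρ n)]
  (hρ : ∀ n, (ρ n).fst.map Subtype.val = inputLaw model (S n) (ν n)) {B c : ℝ} {lam : ℕ → ℝ}
include hρ

lemma ae_eventually_goodData (hρ_int : ∀ n, Integrable Prod.snd (ρ n))
    (hB : ∀ n, ∀ᵐ z ∂(ρ n).fst, |groundTruth (ρ n) z| ≤ B) {Ω : Type*} [MeasurableSpace Ω]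
    {μ : Measure Ω} {X : (n : ℕ) → Fin n → Ω → 𝒳 n} (hX : ∀ n i, HasLaw (X n i) (ρ n).fst μ)
    (hK : ∀ᵐ ω ∂μ, ∀ᶠ n in atTop,
      ∀ e ∈ spectrum ℝ (ridgeMatrix g (effDim (S n)) (lam n) fun i => X n i ω), c ≤ e)
    {δ : ℝ} (hδ : 0 < δ) :
    ∀ᵐ ω ∂μ, ∀ᶠ n in atTop,
      GoodData model (ρ n) g (effDim (S n)) δ B c (lam n) fun i => X n i ω := by
  have htypical : ∀ᵐ ω ∂μ, ∀ n i, |groundTruth (ρ n) (X n i ω)| ≤ B ∧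
      Integrable (fun y => y) ((ρ n).condKernel (X n i ω)) ∧ X n i ω ∈ (ρ n).fst.support := by
    refine ae_all_iff.2 fun n => ae_all_iff.2 fun i =>
      ae_of_ae_map (p := fun z => |groundTruth (ρ n) z| ≤ B ∧
        Integrable (fun y => y) ((ρ n).condKernel z) ∧ z ∈ (ρ n).fst.support)
        (hX n i).aemeasurable ?_
    rw [(hX n i).map_eq]
    exact (hB n).and ((hρ_int n).condKernel_ae.and Measure.support_mem_ae)
  filter_upwards [ae_eventually_forall_normGood hβ hc₀ hS hS1 hd hv hν hρ hX hδ, htypical, hK]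
    with ω hnorm htypical hK
  filter_upwards [hnorm, hK] with n hnorm hK
  exact ⟨hnorm, fun i => (htypical n i).1, fun i => (htypical n i).2.1,
    fun i => (htypical n i).2.2, hK⟩

lemma asympClose_avgEstimator {m : ℕ} (A : KernelApprox model ⌊2 / β⌋₊ m g)
    (hcont : ∀ n, Continuous fun p : 𝒳 n × 𝒳 n => scaledKernel g (effDim (S n)) p.1.1 p.2.1)
    {H : ℕ → Type*} [∀ n, NormedAddCommGroup (H n)] [∀ n, InnerProductSpace ℝ (H n)]
    [∀ n, CompleteSpace (H n)] [∀ n, RKHS ℝ (H n) (𝒳 n) ℝ]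
    (hH : ∀ n (x x' : 𝒳 n), RKHS.kernel (H n) x x' 1 = scaledKernel g (effDim (S n)) x.1 x'.1)
    (hlam : ∀ n, 0 ≤ lam n) (hc : 0 < c) (hB : 0 ≤ B) {x : (n : ℕ) → Fin n → 𝒳 n}
    (hx : ∀ᶠ n in atTop, GoodData model (ρ n) g (effDim (S n)) A.radius B c (lam n) (x n)) :
    AsympClose (fun n => (ρ n).fst) (fun n => avgEstimator (H n) (ρ n) (lam n) (x n))
      fun n z => polyEval (A.approxPoly (effDim (S n)) (avgCoeff g (effDim (S n)) (ρ n) (lam n)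
        (x n)) fun i => (x n i).1) z.1 := by
  have : (0 : ℝ) < v := one_pos.trans_le hv
  obtain ⟨η, hη0, hη, hηq, κ, hκ, γ, hγ, hη_ge⟩ := exists_accuracy hβ hc₀ hd
  refine ⟨fun n => n * (B / c) * (A.bound * η n ^ (⌊2 / β⌋₊ + 1)), tailConst v, κ / (32 * v), γ,
    B / c * (A.index.card * A.bound) * momentConst v (m * 4) ^ (1 / 4 : ℝ), tailConst_nonneg v,
    by positivity, hγ, ?_, ?_⟩
  · have h := hηq.const_mul (B / c * A.bound)
    rw [mul_zero] at h
    exact h.congr fun n => by ring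
  · filter_upwards [hx, hη_ge, hη.eventually (ge_mem_nhds A.radius_pos)] with n hx ⟨hτ, hκη⟩ hηA
    refine (hx.closeOffSmallSet_avgEstimator (hH n) hc hB (hρ n) (hS n) (hS1 n) hτ (hν n) hv
      (hlam n) (hcont n) (hη0 n) hηA).mono (ENNReal.ofReal_le_ofReal ?_)
    have := tailConst_nonneg v
    rw [stretchedExp, div_mul_eq_mul_div]
    gcongr

end Sequence

lemma iInf_polySpace_eLpNorm_sub_sq_le {d m : ℕ} {𝒳 : Set (E d)} (P : Measure 𝒳) (f : 𝒳 → ℝ) :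
    ⨅ p ∈ polySpace d m, eLpNorm (fun z => f z - polyEval p z.1) 2 P ^ 2 ≤ eLpNorm f 2 P ^ 2 :=
  (iInf₂_le 0 (by simp [polySpace])).trans_eq (by simp [polyEval])

end PolyBarrier

end

open PolyBarrier NNReal in
theorem theorem3_general
    (g : ℝ → ℝ → ℝ → ℝ) (β : ℝ) (hβ : 0 < β) (model : InputModel)
    (hg : ExpansionAssumption model β g)
    (d : ℕ → ℕ) (S : (n : ℕ) → Matrix (Fin (d n)) (Fin (d n)) ℝ)
    (hS : ∀ n, (S n).PosSemidef) (hS_norm : ∀ n, ‖S n‖ = 1)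
    (c₀ : ℝ) (hc₀ : 0 < c₀)
    (hd : Tendsto (fun n : ℕ => effDim (S n) / (n : ℝ) ^ β) atTop (𝓝 c₀))
    (v : ℝ≥0) (ν : ℕ → Measure ℝ) (hν : ∀ n, IsSubgaussianUnitLaw v (ν n))
    (𝒳 : (n : ℕ) → Set (E (d n)))
    (ρ : (n : ℕ) → Measure (𝒳 n × ℝ)) [∀ n, IsProbabilityMeasure (ρ n)]
    (hρ : ∀ n, (ρ n).fst.map Subtype.val = inputLaw model (S n) (ν n))
    (hρ_int : ∀ n, Integrable Prod.snd (ρ n))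
    (B : ℝ) (hB : ∀ n, ∀ᵐ x ∂(ρ n).fst, |groundTruth (ρ n) x| ≤ B)
    (hcont : ∀ n, Continuous fun p : 𝒳 n × 𝒳 n =>
      scaledKernel g (effDim (S n)) p.1.1 p.2.1)
    (H : ℕ → Type*) [∀ n, NormedAddCommGroup (H n)] [∀ n, InnerProductSpace ℝ (H n)]
    [∀ n, CompleteSpace (H n)] [∀ n, RKHS ℝ (H n) (𝒳 n) ℝ]
    (hH : ∀ n (x x' : 𝒳 n), RKHS.kernel (H n) x x' 1 =
      scaledKernel g (effDim (S n)) x.1 x'.1)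
    {Ω : Type*} [MeasurableSpace Ω] (μ : Measure Ω)
    (X : (n : ℕ) → Fin n → Ω → 𝒳 n) (hX_law : ∀ n i, HasLaw (X n i) (ρ n).fst μ)
    (lam : ℕ → ℝ) (hlam : ∀ n, 0 ≤ lam n)
    (hK : ∃ c > 0, ∀ᵐ ω ∂μ, ∀ᶠ n in atTop,
      ∀ e ∈ spectrum ℝ (kernelMatrix g (effDim (S n))
        (fun i => X n i ω) + lam n • (1 : Matrix (Fin n) (Fin n) ℝ)), c ≤ e) :
    (∀ ε > 0, ∀ᵐ ω ∂μ, ∀ᶠ n in atTop,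
      (⨅ p ∈ polySpace (d n) (barrierDegree model β),
        eLpNorm (fun z : 𝒳 n => groundTruth (ρ n) z - polyEval p z.1) 2
          (ρ n).fst ^ 2) ≤
        bias (H n) (ρ n) (lam n) (fun i => X n i ω) + ENNReal.ofReal ε) ∧
    (∃ p : (n : ℕ) → (Fin n → 𝒳 n) → MvPolynomial (Fin (d n)) ℝ,
      (∀ n x, p n x ∈ polySpace (d n) (barrierDegree model β)) ∧
      (∀ ε > 0, ∀ r : ℝ, ∀ᵐ ω ∂μ, ∀ᶠ n : ℕ in atTop,
        1 - ENNReal.ofReal ((n : ℝ) ^ 2 * Real.exp (-Real.log n ^ r)) ≤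
          (ρ n).fst {z : 𝒳 n |
            |avgEstimator (H n) (ρ n) (lam n) (fun i => X n i ω) z -
              polyEval (p n fun i => X n i ω) z.1| ≤ ε}) ∧
      ((∃ M : ℝ, ∀ n, ∀ x ∈ (ρ n).fst.support, ∀ x' ∈ (ρ n).fst.support,
          |scaledKernel g (effDim (S n)) x.1 x'.1| ≤ M) →
        ∀ᵐ ω ∂μ, Tendsto (fun n =>
          eLpNorm (fun z : 𝒳 n =>
            avgEstimator (H n) (ρ n) (lam n) (fun i => X n i ω) z -
              polyEval (p n fun i => X n i ω) z.1) 2 (ρ n).fst)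
          atTop (𝓝 0))) := by
  obtain ⟨A⟩ := hg.nonempty_kernelApprox
  obtain ⟨c, hc, hK⟩ := hK
  have hB0 : 0 ≤ B := (hB 0).exists.elim fun _ hx => (abs_nonneg _).trans hx
  have hν' (n : ℕ) : IsSubgaussianUnitLaw (max 1 v) (ν n) := (hν n).mono (le_max_right 1 v)
  have hgood := ae_eventually_goodData hβ hc₀ hS hS_norm hd (le_max_left 1 v) hν' hρ hρ_int hB
    hX_law hK A.radius_pos
  have hclose := hgood.mono fun ω hω => asympClose_avgEstimator hβ hc₀ hS hS_norm hd
    (le_max_left 1 v) hν' hρ A hcont hH hlam hc hB0 hω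
  refine ⟨fun ε hε => ?_, fun n x => A.approxPoly (effDim (S n))
    (avgCoeff g (effDim (S n)) (ρ n) (lam n) x) fun i => (x i).1,
    fun n x => A.approxPoly_mem_polySpace _ _ _, fun ε hε r => ?_, ?_⟩
  · filter_upwards [hclose] with ω hω
    filter_upwards [hω.eventually_min_eLpNorm_sq_le
      (fun n => (hρ_int n).aestronglyMeasurable.integral_condKernel) hB hε] with n hn
    exact (le_min (iInf₂_le _ (A.approxPoly_mem_polySpace _ _ _))
      (iInf_polySpace_eLpNorm_sub_sq_le _ _)).trans hn
  · exact hclose.mono fun ω hω => hω.eventually_one_sub_le_measure hε r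
  · rintro ⟨M, hM⟩
    filter_upwards [hgood, hclose] with ω hgood hclose
    refine hclose.tendsto_eLpNorm_sub (B := B / c * M) ?_
    filter_upwards [hgood] with n hn
    filter_upwards [Measure.support_mem_ae] with z hz
    exact hn.abs_avgEstimator_le (hH n) hc (hlam n) hB0 (hM n) hz

theorem theorem3
    -- the kernel function, the growth rate and the input model
    (g : ℝ → ℝ → ℝ → ℝ) (β : ℝ) (hβ : 0 < β) (model : PolyBarrier.InputModel)
    (hg : PolyBarrier.ExpansionAssumption model β g)
    -- covariance matrices, normalised to operator norm one, and the high-dimensional regime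
    (d : ℕ → ℕ) (S : (n : ℕ) → Matrix (Fin (d n)) (Fin (d n)) ℝ)
    (hS : ∀ n, (S n).PosSemidef) (hS_norm : ∀ n, ‖S n‖ = 1)
    (c₀ : ℝ) (hc₀ : 0 < c₀)
    (hd : Tendsto (fun n : ℕ => PolyBarrier.effDim (S n) / (n : ℝ) ^ β) atTop (𝓝 c₀))
    -- laws of the entries of the latent vectors
    (R : ℝ) (ν : ℕ → Measure ℝ) (hν : ∀ n, PolyBarrier.IsEntryLaw R (ν n))
    -- joint laws of input and response, with inputs in the domain of the kernel
    (𝒳 : (n : ℕ) → Set (PolyBarrier.E (d n)))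
    (ρ : (n : ℕ) → Measure (𝒳 n × ℝ)) [∀ n, IsProbabilityMeasure (ρ n)]
    (hρ : ∀ n, (ρ n).fst.map Subtype.val = PolyBarrier.inputLaw model (S n) (ν n))
    (hρ_int : ∀ n, Integrable Prod.snd (ρ n))
    -- the ground truth is bounded
    (B : ℝ) (hB : ∀ n, ∀ᵐ x ∂(ρ n).fst, |PolyBarrier.groundTruth (ρ n) x| ≤ B)
    -- the kernel at scale `τ = d_eff` is continuous, with reproducing kernel Hilbert space `H n`
    (hcont : ∀ n, Continuous fun p : 𝒳 n × 𝒳 n =>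
      PolyBarrier.scaledKernel g (PolyBarrier.effDim (S n)) p.1.1 p.2.1)
    (H : ℕ → Type*) [∀ n, NormedAddCommGroup (H n)] [∀ n, InnerProductSpace ℝ (H n)]
    [∀ n, CompleteSpace (H n)] [∀ n, RKHS ℝ (H n) (𝒳 n) ℝ]
    (hH : ∀ n (x x' : 𝒳 n), RKHS.kernel (H n) x x' 1 =
      PolyBarrier.scaledKernel g (PolyBarrier.effDim (S n)) x.1 x'.1)
    -- the data sets: for each `n`, `n` independent inputs with law `P_X`
    {Ω : Type*} [MeasurableSpace Ω] (μ : Measure Ω) [IsProbabilityMeasure μ]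
    (X : (n : ℕ) → Fin n → Ω → 𝒳 n) (hX_law : ∀ n i, HasLaw (X n i) (ρ n).fst μ)
    (hX_indep : ∀ n, iIndepFun (X n) μ)
    -- the ridge parameters; the eigenvalues of `K + λ I` are asymptotically bounded below
    (lam : ℕ → ℝ) (hlam : ∀ n, 0 ≤ lam n)
    (hK : ∃ c > 0, ∀ᵐ ω ∂μ, ∀ᶠ n in atTop,
      ∀ e ∈ spectrum ℝ (PolyBarrier.kernelMatrix g (PolyBarrier.effDim (S n))
        (fun i => X n i ω) + lam n • (1 : Matrix (Fin n) (Fin n) ℝ)), c ≤ e) :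
    -- lower bound for the bias
    (∀ ε > 0, ∀ᵐ ω ∂μ, ∀ᶠ n in atTop,
      (⨅ p ∈ PolyBarrier.polySpace (d n) (PolyBarrier.barrierDegree model β),
        eLpNorm (fun z : 𝒳 n => PolyBarrier.groundTruth (ρ n) z - PolyBarrier.polyEval p z.1) 2
          (ρ n).fst ^ 2) ≤
        PolyBarrier.bias (H n) (ρ n) (lam n) (fun i => X n i ω) + ENNReal.ofReal ε) ∧
    -- approximation of the averaged estimator by a polynomial depending on the data set
    (∃ p : (n : ℕ) → (Fin n → 𝒳 n) → MvPolynomial (Fin (d n)) ℝ,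
      (∀ n x, p n x ∈ PolyBarrier.polySpace (d n) (PolyBarrier.barrierDegree model β)) ∧
      (∀ ε > 0, ∀ ε' > 0, ∃ C > 0, ∀ᵐ ω ∂μ, ∀ᶠ n : ℕ in atTop,
        1 - ENNReal.ofReal ((n : ℝ) ^ 2 * Real.exp (-C * Real.log n ^ (1 + ε'))) ≤
          (ρ n).fst {z : 𝒳 n |
            |PolyBarrier.avgEstimator (H n) (ρ n) (lam n) (fun i => X n i ω) z -
              PolyBarrier.polyEval (p n fun i => X n i ω) z.1| ≤ ε}) ∧
      ((∃ M : ℝ, ∀ n, ∀ x ∈ (ρ n).fst.support, ∀ x' ∈ (ρ n).fst.support,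
          |PolyBarrier.scaledKernel g (PolyBarrier.effDim (S n)) x.1 x'.1| ≤ M) →
        ∀ᵐ ω ∂μ, Tendsto (fun n =>
          eLpNorm (fun z : 𝒳 n =>
            PolyBarrier.avgEstimator (H n) (ρ n) (lam n) (fun i => X n i ω) z -
              PolyBarrier.polyEval (p n fun i => X n i ω) z.1) 2 (ρ n).fst)
          atTop (𝓝 0))) := by
  obtain ⟨hbias, p, hp, hprob, hL2⟩ := theorem3_general g β hβ model hg d S hS hS_norm c₀ hc₀ hd _
    ν (fun n => (hν n).isSubgaussianUnitLaw) 𝒳 ρ hρ hρ_int B hB hcont H hH μ X hX_law lam hlam hK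
  exact ⟨hbias, p, hp, fun ε hε ε' _ => ⟨1, one_pos, by
    simpa only [Real.rpow_natCast, neg_one_mul] using hprob ε hε (1 + ε' : ℕ)⟩, hL2⟩
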